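/- Let $a=\mathrm{diag}(i,-i)$, $b=-a/4$, let $q:\mathbb R^2\to\mathbb R$ be a smooth solution of the sine-Gordon equation $q_{xt}=\sin q$, let $s\in\mathbb R\setminus\{0\}$ and $c_0\in\mathbb R$, and put $$u=\begin{pmatrix}0&q_x/2\\-q_x/2&0\end{pmatrix},\qquad f_0=\tfrac12\,(q(0,0)+c_0),\qquad z=is,$$ $$\pi=\begin{pmatrix}\cos^2\frac{f_0}{2}&\sin\frac{f_0}{2}\cos\frac{f_0}{2}\\ \sin\frac{f_0}{2}\cos\frac{f_0}{2}&\sin^2\frac{f_0}{2}\end{pmatrix},\qquad g_{z,\pi}(\lambda)=\pi+\frac{\lambda-z}{\lambda-\bar z}(I-\pi).$$ Then $\pi$ is the Hermitian projection of $\mathbb C^2$ onto the line spanned by $(\cos\frac{f_0}2,\sin\frac{f_0}2)^t$; the loop $g_{is,\pi}$ is rational, equals $I$ at $\infty$, and satisfies $g(\bar\lambda)^*g(\lambda)=I$ and $g(-\lambda)^tg(\lambda)=I$. The function $u$ takes values in $\{y\in su(2): -y^t=y,\ \mathrm{tr}(ay)=0\}$ and solves the $-1$ flow $u_t=[a,g^{-1}bg]$,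 $g^{-1}g_x=u$, with the frame $g=\begin{pmatrix}\cos\frac q2&\sin\frac q2\\-\sin\frac q2&\cos\frac q2\end{pmatrix}$. If for every $t$ the limit of $q(x,t)$ as $x\to-\infty$ exists and lies in $2\pi\mathbb Z$, then $u$ also solves it with a frame normalized by $\lim_{x\to-\infty}g(x,t)=I$. In what follows $g$ is the first of these frames or, under this condition on $q$, any frame of $u$ for the $-1$ flow that is so normalized. Let $E(x,t,\lambda)$, $\lambda\in\mathbb C\setminus\{0\}$, be the trivialization of $u$: $E_x=E(a\lambda+u)$, $E_t=E\lambda^{-1}g^{-1}bg$, $E(0,0,\lambda)=I$. Write $\tilde u=g_{is,\pi}\ast u$ if $g_{is,\pi}E(x,t)=\tilde E(x,t)\,\tilde g(x,t)$ for all $(x,t)$, where $\tilde E(x,t)$ is a holomorphic map $\mathbb C\setminus\{0\}\to GL(2,\mathbb C)$, $\tilde g(x,t)$ is a rational map equal to $I$ at $\infty$, both satisfy $h(\bar\lambda)^*h(\lambda)=I$, and $\tilde E^{-1}\tilde E_x=a\lambda+\tilde u$. (1) There is exactly one function $q^*=B_{s,c_0}(q)$ on $\mathbb R^2$ (the classical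 Bäcklund transform of $q$) with $$(q^*-q)_x=4s\sin\frac{q^*+q}{2},\qquad (q^*+q)_t=\frac1s\sin\frac{q^*-q}{2},\qquad q^*(0,0)=c_0,$$ and it is again a smooth solution of the sine-Gordon equation. (2) $g_{is,\pi}\ast u$ exists, is unique, and corresponds to $B_{s,c_0}(q)$: $$g_{is,\pi}\ast u=\begin{pmatrix}0&q^*_x/2\\-q^*_x/2&0\end{pmatrix}.$$ (3) Let $\tilde\pi(x,t)$ be the Hermitian projection onto $E(x,t,is)^*(\pi(\mathbb C^2))$. Then $\tilde\pi$ is the real Hermitian projection onto the line spanned by $(\cos\frac f2,\sin\frac f2)^t$ with $f=\frac12(q^*+q)$, $g_{is,\pi}\ast u=u+(z-\bar z)[\tilde\pi,a]$, and $\tilde\pi$ is the unique solution of $$\tilde\pi_x+[az+u,\tilde\pi]=(\bar z-z)[\tilde\pi,a]\tilde\pi,\qquad \tilde\pi_t=\frac1{|z|^2}\left((z-\bar z)\tilde\pi g^{-1}bg\tilde\pi-zg^{-1}bg\tilde\pi+\bar z\tilde\pi g^{-1}bg\right),$$ $\tilde\pi^*=\tilde\pi$, $\tilde\pi^2=\tilde\pi$,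 $\tilde\pi(0,0)=\pi$. This system reduces to the classical one: if $f:\mathbb R^2\to\mathbb R$ is differentiable in $x$ and in $t$ and $f(0,0)=f_0$, then the Hermitian projections onto the lines spanned by $(\cos\frac{f}{2},\sin\frac{f}{2})^t$ solve it if and only if $2f-q$ satisfies the system in (1). -/

import Mathlib

open scoped ContDiff Topology

noncomputable section

namespace LoopSG

variable {n : Type*} [Fintype n] [DecidableEq n]

/-! ### Loop groups -/

/-- `F` has derivative `F'` at `x`, entry by entry. -/
def HasMatDerivAt (F : ℝ → Matrix n n ℂ) (F' : Matrix n n ℂ) (x : ℝ) : Prop :=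
  ∀ i j, HasDerivAt (fun y => F y i j) (F' i j) x

/-- The group of holomorphic maps `ℂ ∖ {0} → GL(n, ℂ)` with the `U(n)`-reality condition
`f(conj l)^* f(l) = 1` (the value at `0` is irrelevant). -/
structure IsPlusLoop (f : ℂ → Matrix n n ℂ) : Prop where
  holomorphic : ∀ i j, DifferentiableOn ℂ (fun l => f l i j) {0}ᶜ
  invertible : ∀ l, l ≠ 0 → IsUnit (f l).det
  reality : ∀ l, l ≠ 0 → (f (star l)).conjTranspose * f l = 1

/-- The group of rational maps `g` into `GL(n, ℂ)` that are holomorphic at `∞` with `g(∞) = 1`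
and satisfy the `U(n)`-reality condition. A rational map is represented by a function on `ℂ`;
its values at finitely many points (the poles in particular) are irrelevant. -/
structure IsRationalLoop (g : ℂ → Matrix n n ℂ) : Prop where
  rational : ∃ (d : Polynomial ℂ) (P : Matrix n n (Polynomial ℂ)), d ≠ 0 ∧
    ∀ l, d.eval l ≠ 0 → ∀ i j, g l i j = (P i j).eval l / d.eval l
  at_infinity : Filter.Tendsto g (Filter.cocompact ℂ) (𝓝 1)
  reality : ∀ᶠ l in Filter.cofinite, (g (star l)).conjTranspose * g l = 1

/-- Rational loops with, in addition, `σ(g(-l)) = g(l)` for the involution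
`σ(y) = (yᵗ)⁻¹`. -/
structure IsTwistedRationalLoop (g : ℂ → Matrix n n ℂ) : Prop extends IsRationalLoop g where
  twisted : ∀ᶠ l in Filter.cofinite, (g (-l)).transpose * g l = 1

/-- `p` is the Hermitian projection of `ℂⁿ` onto `V`. -/
structure IsHermitianProjectionOnto (p : Matrix n n ℂ) (V : Submodule ℂ (n → ℂ)) : Prop where
  hermitian : p.conjTranspose = p
  idempotent : p * p = p
  range_eq : LinearMap.range (Matrix.toLin' p) = V

/-- The simple element `g_{z,p}(l) = p + ((l - z) / (l - conj z)) (1 - p)`. -/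
def simpleElement (z : ℂ) (p : Matrix n n ℂ) (l : ℂ) : Matrix n n ℂ :=
  p + ((l - z) / (l - star z)) • (1 - p)

/-! ### The `-1` flow, its trivialization, and the dressing action -/

/-- The space of `y ∈ su(n)` with `-yᵗ = y` and `tr (a y) = 0`. -/
def twistedPerp (a : Matrix n n ℂ) : Set (Matrix n n ℂ) :=
  {y | y.conjTranspose = -y ∧ y.trace = 0 ∧ -y.transpose = y ∧ (a * y).trace = 0}

/-- `u` solves the `-1` flow `u_t = [a, g⁻¹ b g]`, `g⁻¹ g_x = u`, with frame `g`. -/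
structure IsMinusOneFlow (a b : Matrix n n ℂ) (u g : ℝ → ℝ → Matrix n n ℂ) : Prop where
  smooth : ∀ i j, ContDiff ℝ ∞ (fun p : ℝ × ℝ => u p.1 p.2 i j)
  frame_invertible : ∀ x t, IsUnit (g x t).det
  frame_x : ∀ x t, HasMatDerivAt (fun y => g y t) (g x t * u x t) x
  flow : ∀ x t, HasMatDerivAt (fun τ => u x τ)
    (a * ((g x t)⁻¹ * b * g x t) - ((g x t)⁻¹ * b * g x t) * a) t

/-- The normalization `g → 1` as `x → -∞` of the frame. -/
def IsNormalizedFrame (g : ℝ → ℝ → Matrix n n ℂ) : Prop :=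
  ∀ t, Filter.Tendsto (fun x => g x t) Filter.atBot (𝓝 1)

/-- `E` is the trivialization, normalized at `(0,0)`, of the Lax pair of the `-1` flow:
`E_x = E (a l + u)`, `E_t = E (l⁻¹ g⁻¹ b g)`, `E(0,0,l) = 1`, for `l ≠ 0`. -/
structure IsTrivialization (a b : Matrix n n ℂ) (u g : ℝ → ℝ → Matrix n n ℂ)
    (E : ℝ → ℝ → ℂ → Matrix n n ℂ) : Prop where
  base : ∀ l, l ≠ 0 → E 0 0 l = 1
  deriv_x : ∀ x t l, l ≠ 0 → HasMatDerivAt (fun y => E y t l) (E x t l * (l • a + u x t)) x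
  deriv_t : ∀ x t l, l ≠ 0 →
    HasMatDerivAt (fun τ => E x τ l) (E x t l * (l⁻¹ • ((g x t)⁻¹ * b * g x t))) t

/-- `v = k ∗ u`: with `E` the trivialization of `u`, the loop `k E(x,t)` is factored as
`F(x,t) m(x,t)`, with `F(x,t)` holomorphic on `ℂ ∖ {0}` and `m(x,t)` rational (both real), and
`F⁻¹ F_x = a l + v`. -/
def IsDressing (a b : Matrix n n ℂ) (u g : ℝ → ℝ → Matrix n n ℂ) (k : ℂ → Matrix n n ℂ)
    (v : ℝ → ℝ → Matrix n n ℂ) : Prop :=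
  ∃ (E F m : ℝ → ℝ → ℂ → Matrix n n ℂ),
    IsTrivialization a b u g E ∧
    (∀ x t, IsPlusLoop (F x t)) ∧
    (∀ x t, IsRationalLoop (m x t)) ∧
    (∀ x t, ∀ᶠ l in Filter.cofinite, k l * E x t l = F x t l * m x t l) ∧
    (∀ x t l, l ≠ 0 → HasMatDerivAt (fun y => F y t l) (F x t l * (l • a + v x t)) x)

/-- The first order system for the projection `P`, with parameter `z` and initial
condition `p`. -/
structure IsProjectionSystem (a b : Matrix n n ℂ) (u g : ℝ → ℝ → Matrix n n ℂ) (z : ℂ)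
    (p : Matrix n n ℂ) (P : ℝ → ℝ → Matrix n n ℂ) : Prop where
  deriv_x : ∀ x t, HasMatDerivAt (fun y => P y t)
    ((star z - z) • ((P x t * a - a * P x t) * P x t)
      - ((z • a + u x t) * P x t - P x t * (z • a + u x t))) x
  deriv_t : ∀ x t, HasMatDerivAt (fun τ => P x τ)
    (((‖z‖ ^ 2 : ℝ) : ℂ)⁻¹ •
      ((z - star z) • (P x t * ((g x t)⁻¹ * b * g x t) * P x t)
        - z • (((g x t)⁻¹ * b * g x t) * P x t)
        + star z • (P x t * ((g x t)⁻¹ * b * g x t)))) t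
  hermitian : ∀ x t, (P x t).conjTranspose = P x t
  idempotent : ∀ x t, P x t * P x t = P x t
  base : P 0 0 = p

/-! ### The sine-Gordon equation -/

/-- `q` is a smooth solution on `ℝ²` of `q_{xt} = sin q`. -/
structure IsSineGordon (q : ℝ → ℝ → ℝ) : Prop where
  smooth : ContDiff ℝ ∞ (fun p : ℝ × ℝ => q p.1 p.2)
  eqn : ∀ x t, deriv (fun τ => deriv (fun y => q y τ) x) t = Real.sin (q x t)

/-- `r` is a solution of the classical Bäcklund system of `q` with parameter `s`
and `r(0,0) = c`. -/
structure IsClassicalBacklund (s c : ℝ) (q r : ℝ → ℝ → ℝ) : Prop where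
  deriv_x : ∀ x t, HasDerivAt (fun y => r y t - q y t)
    (4 * s * Real.sin ((r x t + q x t) / 2)) x
  deriv_t : ∀ x t, HasDerivAt (fun τ => r x τ + q x τ)
    (1 / s * Real.sin ((r x t - q x t) / 2)) t
  base : r 0 0 = c

/-- `a = diag(i, -i)`. -/
def sgA : Matrix (Fin 2) (Fin 2) ℂ := !![Complex.I, 0; 0, -Complex.I]

/-- `b = -a/4`. -/
def sgB : Matrix (Fin 2) (Fin 2) ℂ := (-(1 / 4) : ℂ) • sgA

/-- `u = [[0, q_x/2], [-q_x/2, 0]]`. -/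
def sgPotential (q : ℝ → ℝ → ℝ) (x t : ℝ) : Matrix (Fin 2) (Fin 2) ℂ :=
  !![0, ((deriv (fun y => q y t) x / 2 : ℝ) : ℂ);
     ((-(deriv (fun y => q y t) x / 2) : ℝ) : ℂ), 0]

/-- The frame `exp ((q/2) J)`, `J = [[0, 1], [-1, 0]]`. -/
def sgFrame (q : ℝ → ℝ → ℝ) (x t : ℝ) : Matrix (Fin 2) (Fin 2) ℂ :=
  !![((Real.cos (q x t / 2) : ℝ) : ℂ), ((Real.sin (q x t / 2) : ℝ) : ℂ);
     ((-Real.sin (q x t / 2) : ℝ) : ℂ), ((Real.cos (q x t / 2) : ℝ) : ℂ)]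

/-- The boundary condition `q(x,t) → 0` modulo `2π` as `x → -∞`. -/
def VanishesAtBot (q : ℝ → ℝ → ℝ) : Prop :=
  ∀ t, ∃ k : ℤ, Filter.Tendsto (fun x => q x t) Filter.atBot (𝓝 (2 * Real.pi * k))

/-- The frames through which a sine-Gordon solution `q` is viewed as a solution of the `-1` flow:
the frame `exp ((q/2) J)`, which needs no condition at `x = -∞`, and, if `q → 0` modulo `2π` there,
every frame normalized by `g → 1`. -/
def IsSineGordonFrame (q : ℝ → ℝ → ℝ) (g : ℝ → ℝ → Matrix (Fin 2) (Fin 2) ℂ) : Prop :=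
  IsMinusOneFlow sgA sgB (sgPotential q) g ∧
    (g = sgFrame q ∨ (VanishesAtBot q ∧ IsNormalizedFrame g))

/-- The complex line spanned by `(cos (f/2), sin (f/2))`. -/
def angleLine (f : ℝ) : Submodule ℂ (Fin 2 → ℂ) :=
  Submodule.span ℂ {![((Real.cos (f / 2) : ℝ) : ℂ), ((Real.sin (f / 2) : ℝ) : ℂ)]}

/-- The matrix of the Hermitian projection onto `angleLine f`. -/
def angleProj (f : ℝ) : Matrix (Fin 2) (Fin 2) ℂ :=
  !![((Real.cos (f / 2) ^ 2 : ℝ) : ℂ), ((Real.sin (f / 2) * Real.cos (f / 2) : ℝ) : ℂ);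
     ((Real.sin (f / 2) * Real.cos (f / 2) : ℝ) : ℂ), ((Real.sin (f / 2) ^ 2 : ℝ) : ℂ)]

end LoopSG

end

open LoopSG

/-!
The Lax pair of `q` is the flat connection `(a l + u) dx + l⁻¹ Q dt`, `Q = -(i/4) R_q`, where
`R_θ = [[cos θ, sin θ], [sin θ, -cos θ]]`. If `P` solves the system for the projection, then gauging
by `k = g_{z,P}` turns the connection into one of the same shape, with potential
`u + (z - conj z) [P, a]` and with `k(0) Q k(0)⁻¹` in place of `Q`; so `k` intertwines the two
trivializations, which is the factorization defining the dressing action, and evaluating the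
intertwining relation at `l = z` gives the range of `P`. Uniqueness of the factorization is
Liouville's theorem.

For the projection `P = (1 + R_f) / 2` onto the line of angle `f / 2` both equations of the system
are multiples of `R_f J`, and comparing coefficients leaves the Bäcklund system for `f`. Moreover
`k(0) = R_f`, so `k(0) Q k(0)⁻¹ = -(i/4) R_{2f-q}`, and the dressed connection is the Lax pair of
`2f - q`.
-/

noncomputable section

namespace LoopSG

open Matrix Filter
open scoped NNReal

/-! ### Ordinary differential equations -/

section ODE

variable {M V : Type*} [TopologicalSpace M] [NormedAddCommGroup V]

/-- The family of maps `v m : V → V` is Lipschitz with a common constant for `m` in a compact set: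
the condition under which the equation `y' = v x y` is globally solvable (here `M = ℝ`), depends
nicely on parameters (`M = ℝ × 𝕜`), and has unique solutions. -/
def LipschitzOnCompacts (v : M → V → V) : Prop :=
  ∀ s, IsCompact s → ∃ K : ℝ≥0, ∀ m ∈ s, LipschitzWith K (v m)

theorem LipschitzOnCompacts.comp {N : Type*} [TopologicalSpace N] {v : M → V → V} {φ : N → M}
    (hv : LipschitzOnCompacts v) (hφ : Continuous φ) : LipschitzOnCompacts fun m => v (φ m) := by
  intro s hs
  obtain ⟨K, hK⟩ := hv _ (hs.image hφ)
  exact ⟨K, fun m hm => hK _ (Set.mem_image_of_mem φ hm)⟩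

theorem eventually_norm_taylor_le_of_isCompact {𝕜 : Type*} [RCLike 𝕜] [NormedSpace 𝕜 V]
    {φ φ' : M → 𝕜 → V} (hφ : ∀ m h, HasDerivAt (φ m) (φ' m h) h)
    (hφ' : Continuous φ'.uncurry) {s : Set M} (hs : IsCompact s) {ε : ℝ} (hε : 0 < ε) :
    ∀ᶠ h in 𝓝 (0 : 𝕜), ∀ m ∈ s, ‖φ m h - φ m 0 - h • φ' m 0‖ ≤ ε * ‖h‖ := by
  have hclose : ∀ᶠ h in 𝓝 (0 : 𝕜), ∀ m ∈ s, ‖φ' m h - φ' m 0‖ < ε := by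
    refine hs.eventually_forall_of_forall_eventually fun m _ => ?_
    have hcont : Continuous fun p : 𝕜 × M => ‖φ' p.2 p.1 - φ' p.2 0‖ := by fun_prop
    exact hcont.continuousAt.eventually_lt continuousAt_const (by simpa using hε)
  obtain ⟨r, hr, hball⟩ := Metric.eventually_nhds_iff_ball.mp hclose
  filter_upwards [Metric.ball_mem_nhds 0 hr] with h hh m hm
  have hderiv (y : 𝕜) : HasDerivAt (fun y => φ m y - y • φ' m 0) (φ' m y - φ' m 0) y := by
    simpa using! (hφ m y).sub ((hasDerivAt_id y).smul_const (φ' m 0))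
  simpa [sub_right_comm] using
    (convex_ball (0 : 𝕜) r).norm_image_sub_le_of_norm_hasDerivWithin_le
      (fun y _ => (hderiv y).hasDerivWithinAt) (fun y hy => (hball y hy m hm).le)
      (Metric.mem_ball_self hr) hh

variable [NormedSpace ℝ V]

theorem LipschitzOnCompacts.of_continuousLinearMap {L : M → V →L[ℝ] V} (hL : Continuous L)
    (F : M → V) : LipschitzOnCompacts fun m y => L m y + F m := by
  intro s hs
  obtain ⟨K, hK⟩ := hs.exists_bound_of_continuousOn hL.continuousOn
  refine ⟨K.toNNReal, fun m hm => ?_⟩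
  refine (((L m).lipschitz.add (LipschitzWith.const (F m))).weaken ?_)
  rw [add_zero, ← norm_toNNReal]
  exact Real.toNNReal_le_toNNReal (hK m hm)

theorem norm_le_of_norm_deriv_le_deriv_boundary {f f' : ℝ → V} {B B' : ℝ → ℝ} {x R : ℝ}
    (hf : ∀ y, HasDerivAt f (f' y) y) (h0 : ‖f 0‖ ≤ B 0) (hB : ∀ y, HasDerivAt B (B' y) y)
    (bound : ∀ y, |y| ≤ R → ‖f' y‖ ≤ B' |y|) (hx : |x| ≤ R) : ‖f x‖ ≤ B |x| := by
  wlog hx0 : 0 ≤ x generalizing f f' x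
  · have hneg : ∀ y, HasDerivAt (fun y => f (-y)) (-f' (-y)) y := fun y =>
      ((hf (-y)).scomp y (hasDerivAt_neg y)).congr_deriv (neg_one_smul ℝ _)
    simpa using this hneg (by simpa using h0) (fun y hy => by simpa using bound (-y) (by simpa))
      (x := -x) (by simpa) (by linarith)
  rw [abs_of_nonneg hx0] at hx ⊢
  refine image_norm_le_of_norm_deriv_right_le_deriv_boundary
    (fun y _ => (hf y).continuousAt.continuousWithinAt) (fun y _ => (hf y).hasDerivWithinAt)
    h0 hB (fun y hy => ?_) ⟨hx0, hx⟩
  have hy_abs : |y| = y := abs_of_nonneg hy.1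
  simpa only [hy_abs] using bound y (hy_abs.le.trans hy.2.le)

theorem norm_le_gronwallBound_abs {f f' : ℝ → V} {δ K ε x R : ℝ}
    (hf : ∀ y, HasDerivAt f (f' y) y) (h0 : ‖f 0‖ ≤ δ)
    (bound : ∀ y, |y| ≤ R → ‖f' y‖ ≤ K * ‖f y‖ + ε) (hx : |x| ≤ R) :
    ‖f x‖ ≤ gronwallBound δ K ε |x| := by
  wlog hx0 : 0 ≤ x generalizing f f' x
  · have hneg : ∀ y, HasDerivAt (fun y => f (-y)) (-f' (-y)) y := fun y =>
      ((hf (-y)).scomp y (hasDerivAt_neg y)).congr_deriv (neg_one_smul ℝ _)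
    simpa using this hneg (by simpa using h0) (fun y hy => by simpa using bound (-y) (by simpa))
      (x := -x) (by simpa) (by linarith)
  rw [abs_of_nonneg hx0] at hx ⊢
  simpa using norm_le_gronwallBound_of_norm_deriv_right_le
    (fun y _ => (hf y).continuousAt.continuousWithinAt) (fun y _ => (hf y).hasDerivWithinAt)
    h0 (fun y hy => bound y ((abs_of_nonneg hy.1).le.trans hy.2.le)) x ⟨hx0, hx⟩

theorem gronwallBound_le {δ K ε x : ℝ} (hK : 1 ≤ K) (hε : 0 ≤ ε) :
    gronwallBound δ K ε x ≤ (δ + ε) * Real.exp (K * x) := by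
  have hexp : Real.exp (K * x) - 1 ≤ Real.exp (K * x) := by linarith
  rw [gronwallBound_of_K_ne_0 (by positivity), add_mul]
  refine add_le_add_right ?_ _
  exact (mul_le_mul_of_nonneg_left hexp (by positivity)).trans
    (mul_le_mul_of_nonneg_right (div_le_self hε hK) (Real.exp_pos _).le)

/-- The Picard iterates of the initial value problem `y' = v x y`, `y(0) = y₀`. -/
def picardIterate (v : ℝ → V → V) (y₀ : V) : ℕ → ℝ → V
  | 0 => fun _ => y₀
  | k + 1 => fun x => y₀ + ∫ ξ in (0 : ℝ)..x, v ξ (picardIterate v y₀ k ξ)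

section Picard

variable {v : ℝ → V → V} {y₀ : V}

theorem picardIterate_apply_zero (k : ℕ) : picardIterate v y₀ k 0 = y₀ := by
  cases k <;> simp [picardIterate]

theorem continuous_picardIterate (hv : Continuous v.uncurry) (k : ℕ) :
    Continuous (picardIterate v y₀ k) := by
  induction k with
  | zero => exact continuous_const
  | succ k ih =>
    have hint : Continuous fun ξ => v ξ (picardIterate v y₀ k ξ) :=
      hv.comp (continuous_id.prodMk ih)
    exact continuous_const.add
      (intervalIntegral.continuous_primitive (fun _ _ => hint.intervalIntegrable _ _) 0)

variable [CompleteSpace V]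

theorem hasDerivAt_picardIterate_succ (hv : Continuous v.uncurry) (k : ℕ) (x : ℝ) :
    HasDerivAt (picardIterate v y₀ (k + 1)) (v x (picardIterate v y₀ k x)) x := by
  have hint : Continuous fun ξ => v ξ (picardIterate v y₀ k ξ) :=
    hv.comp (continuous_id.prodMk (continuous_picardIterate hv k))
  exact (intervalIntegral.integral_hasDerivAt_right (hint.intervalIntegrable _ _)
    hint.stronglyMeasurable.stronglyMeasurableAtFilter hint.continuousAt).const_add y₀

theorem norm_picardIterate_succ_sub_le (hv : Continuous v.uncurry) {K C R x : ℝ} (hK : 1 ≤ K)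
    (hlip : ∀ y, |y| ≤ R → ∀ w w', ‖v y w - v y w'‖ ≤ K * ‖w - w'‖)
    (hC : ∀ y, |y| ≤ R → ‖v y y₀‖ ≤ C) (k : ℕ) (hx : |x| ≤ R) :
    ‖picardIterate v y₀ (k + 1) x - picardIterate v y₀ k x‖
      ≤ C * (1 / 2) ^ k * Real.exp (2 * K * |x|) := by
  have hR : |(0 : ℝ)| ≤ R := by simpa using (abs_nonneg x).trans hx
  have hC0 : 0 ≤ C := (norm_nonneg _).trans (hC 0 hR)
  have hexp (c y : ℝ) :
      HasDerivAt (fun y => c * Real.exp (2 * K * y)) (c * (2 * K) * Real.exp (2 * K * y)) y :=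
    ((((hasDerivAt_id y).const_mul (2 * K)).exp).const_mul c).congr_deriv (by ring_nf; rfl)
  induction k generalizing x with
  | zero =>
    refine norm_le_of_norm_deriv_le_deriv_boundary
      (fun y => (hasDerivAt_picardIterate_succ hv 0 y).sub_const y₀) ?_ (hexp _)
      (fun y hy => (hC y hy).trans ?_) hx
    · rw [picardIterate_apply_zero, sub_self, norm_zero]
      positivity
    · have h1 : 1 ≤ Real.exp (2 * K * |y|) := Real.one_le_exp (by positivity)
      have h2 : C ≤ C * (2 * K) := le_mul_of_one_le_right hC0 (by linarith)
      simpa using h2.trans (le_mul_of_one_le_right (by positivity) h1)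
  | succ k ih =>
    refine norm_le_of_norm_deriv_le_deriv_boundary (fun y =>
      (hasDerivAt_picardIterate_succ hv (k + 1) y).sub (hasDerivAt_picardIterate_succ hv k y))
      ?_ (hexp _) (fun y hy => (hlip y hy _ _).trans ?_) hx
    · rw [Pi.sub_apply, picardIterate_apply_zero, picardIterate_apply_zero, sub_self, norm_zero]
      positivity
    · calc K * ‖picardIterate v y₀ (k + 1) y - picardIterate v y₀ k y‖
          ≤ K * (C * (1 / 2) ^ k * Real.exp (2 * K * |y|)) := by gcongr; exact ih hy
        _ = C * (1 / 2) ^ (k + 1) * (2 * K) * Real.exp (2 * K * |y|) := by ring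

theorem LipschitzOnCompacts.tendstoUniformlyOn_picardIterate (hl : LipschitzOnCompacts v)
    (hv : Continuous v.uncurry) (y₀ : V) :
    ∃ γ : ℝ → V, ∀ R, TendstoUniformlyOn (picardIterate v y₀) γ atTop (Metric.ball 0 R) := by
  have geometric (R : ℝ) : ∃ C, ∀ x, |x| ≤ R → ∀ k,
      dist (picardIterate v y₀ k x) (picardIterate v y₀ (k + 1) x) ≤ C * (1 / 2) ^ k := by
    have hcpt : IsCompact {x : ℝ | |x| ≤ R} := by
      simpa [abs_le] using! isCompact_Icc (a := -R) (b := R)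
    obtain ⟨K, hK⟩ := hl _ hcpt
    obtain ⟨C, hC⟩ := hcpt.exists_bound_of_continuousOn (f := fun x => v x y₀)
      (hv.comp (continuous_id.prodMk continuous_const)).continuousOn
    refine ⟨C * Real.exp (2 * (K + 1) * R), fun x hx k => ?_⟩
    have hC0 : 0 ≤ C := (norm_nonneg _).trans (hC x hx)
    have hlip : ∀ y, |y| ≤ R → ∀ w w', ‖v y w - v y w'‖ ≤ (K + 1) * ‖w - w'‖ :=
      fun y hy w w' => ((hK y hy).norm_sub_le w w').trans (by gcongr; simp)
    rw [dist_comm, dist_eq_norm]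
    calc _ ≤ C * (1 / 2) ^ k * Real.exp (2 * (K + 1) * |x|) :=
          norm_picardIterate_succ_sub_le hv (by simp) hlip hC k hx
      _ ≤ C * (1 / 2) ^ k * Real.exp (2 * (K + 1) * R) := by gcongr
      _ = _ := by ring
  have pointwise (x : ℝ) : ∃ y, Tendsto (fun k => picardIterate v y₀ k x) atTop (𝓝 y) := by
    obtain ⟨C, hC⟩ := geometric |x|
    exact cauchySeq_tendsto_of_complete
      (cauchySeq_of_le_geometric _ C (by norm_num) (hC x le_rfl))
  choose γ hγ using pointwise
  refine ⟨γ, fun R => Metric.tendstoUniformlyOn_iff.mpr fun ε hε => ?_⟩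
  obtain ⟨C, hC⟩ := geometric R
  have hlim : Tendsto (fun k => C * (1 / 2 : ℝ) ^ k / (1 - 1 / 2)) atTop (𝓝 0) := by
    simpa using ((tendsto_pow_atTop_nhds_zero_of_lt_one (r := (1 / 2 : ℝ)) (by norm_num)
      (by norm_num)).const_mul C).div_const (1 - 1 / 2)
  filter_upwards [hlim.eventually (gt_mem_nhds hε)] with k hk x hx
  rw [dist_comm]
  exact (dist_le_of_le_geometric_of_tendsto (1 / 2) C (by norm_num)
    (hC x (by simpa using (Metric.mem_ball.mp hx).le)) (hγ x) k).trans_lt hk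

theorem LipschitzOnCompacts.exists_isIntegralCurve (hl : LipschitzOnCompacts v)
    (hv : Continuous v.uncurry) (y₀ : V) : ∃ γ : ℝ → V, γ 0 = y₀ ∧ IsIntegralCurve γ v := by
  obtain ⟨γ, hγ⟩ := hl.tendstoUniformlyOn_picardIterate hv y₀
  have hlim (x : ℝ) : Tendsto (fun k => picardIterate v y₀ k x) atTop (𝓝 (γ x)) :=
    (hγ (|x| + 1)).tendsto_at (by simp)
  refine ⟨γ, tendsto_nhds_unique (hlim 0) (by simp [picardIterate_apply_zero]), fun x => ?_⟩
  obtain ⟨K, hK⟩ := hl _ (isCompact_closedBall (0 : ℝ) (|x| + 1))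
  refine hasDerivAt_of_tendstoUniformlyOn (f := fun k => picardIterate v y₀ (k + 1))
    (f' := fun k y => v y (picardIterate v y₀ k y)) (g' := fun y => v y (γ y))
    (Metric.isOpen_ball (x := (0 : ℝ)) (ε := |x| + 1)) ?_
    (Eventually.of_forall fun k y _ => hasDerivAt_picardIterate_succ hv k y)
    (fun y _ => (hlim y).comp (tendsto_add_atTop_nat 1)) (by simp)
  rw [Metric.tendstoUniformlyOn_iff]
  intro ε hε
  have hKpos : (0 : ℝ) < K + 1 := by positivity
  filter_upwards [Metric.tendstoUniformlyOn_iff.mp (hγ (|x| + 1)) _ (div_pos hε hKpos)]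
    with k hk y hy
  calc dist (v y (γ y)) (v y (picardIterate v y₀ k y))
      ≤ K * dist (γ y) (picardIterate v y₀ k y) :=
        (hK y (Metric.ball_subset_closedBall hy)).dist_le_mul _ _
    _ ≤ (K + 1) * dist (γ y) (picardIterate v y₀ k y) := by gcongr; simp
    _ < (K + 1) * (ε / (K + 1)) := by gcongr; exact hk y hy
    _ = ε := mul_div_cancel₀ _ hKpos.ne'

end Picard

theorem LipschitzOnCompacts.eq_of_isIntegralCurve {v : ℝ → V → V} (hl : LipschitzOnCompacts v)
    {γ δ : ℝ → V} (hγ : IsIntegralCurve γ v) (hδ : IsIntegralCurve δ v) (h0 : γ 0 = δ 0) :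
    γ = δ := by
  funext x
  obtain ⟨K, hK⟩ := hl _ (isCompact_Icc (a := -(|x| + 1)) (b := |x| + 1))
  have hmem : x ∈ Set.Ioo (-(|x| + 1)) (|x| + 1) := abs_lt.mp (lt_add_one _)
  exact ODE_solution_unique_of_mem_Ioo (s := fun _ => Set.univ) (K := K)
    (fun y hy => (hK y (Set.Ioo_subset_Icc_self hy)).lipschitzOnWith)
    ⟨by linarith [abs_nonneg x], by positivity⟩ (fun y _ => ⟨hγ y, trivial⟩)
    (fun y _ => ⟨hδ y, trivial⟩) h0 hmem

theorem hasDerivAt_integralCurve_parameter {𝕜 : Type*} [RCLike 𝕜] [NormedSpace 𝕜 V]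
    [SMulCommClass ℝ 𝕜 V] {X : ℝ → 𝕜 → V → V} {Y : ℝ → 𝕜 → V} {W : ℝ → V} {φ' : ℝ → 𝕜 → V}
    {τ : 𝕜} (hX : LipschitzOnCompacts fun m : ℝ × 𝕜 => X m.1 m.2)
    (hY : ∀ᶠ μ in 𝓝 τ, IsIntegralCurve (fun x => Y x μ) fun x => X x μ)
    (hφ : ∀ x h, HasDerivAt (fun h => X x (τ + h) (Y x τ + h • W x)) (φ' x h) h)
    (hφ' : Continuous φ'.uncurry) (hW : ∀ x, HasDerivAt W (φ' x 0) x)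
    (h0 : HasDerivAt (Y 0) (W 0) τ) (x : ℝ) : HasDerivAt (Y x) (W x) τ := by
  obtain ⟨K, hK⟩ := hX _ ((isCompact_closedBall (0 : ℝ) |x|).prod (isCompact_closedBall τ 1))
  rw [hasDerivAt_iff_isLittleO_nhds_zero, Asymptotics.isLittleO_iff] at h0 ⊢
  intro ε hε
  obtain ⟨η, hη, hηε⟩ : ∃ η > 0, (η + η) * Real.exp ((K + 1) * |x|) = ε :=
    ⟨ε / (2 * Real.exp ((K + 1) * |x|)), by positivity, by field_simp; norm_num⟩
  have hYτ : IsIntegralCurve (fun x => Y x τ) fun x => X x τ := hY.self_of_nhds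
  have hshift : Tendsto (fun h => τ + h) (𝓝 0) (𝓝 τ) := by
    simpa using (continuous_const_add τ).tendsto 0
  filter_upwards [h0 hη, eventually_norm_taylor_le_of_isCompact hφ hφ'
      (isCompact_closedBall (0 : ℝ) |x|) hη, hshift.eventually hY,
    Metric.closedBall_mem_nhds (0 : 𝕜) one_pos] with h hinit htaylor hYh hh
  have hlip (y : ℝ) (hy : |y| ≤ |x|) :
      ‖X y (τ + h) (Y y (τ + h)) - X y (τ + h) (Y y τ + h • W y)‖
        ≤ (K + 1) * ‖Y y (τ + h) - Y y τ - h • W y‖ := by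
    rw [sub_sub]
    refine ((hK (y, τ + h) ⟨by simpa using hy, by simpa using hh⟩).norm_sub_le _ _).trans ?_
    gcongr
    simp
  refine (norm_le_gronwallBound_abs (K := K + 1) (ε := η * ‖h‖)
    (fun y => ((hYh y).sub (hYτ y)).sub ((hW y).const_smul h)) hinit
    (fun y hy => ?_) le_rfl).trans
    ((gronwallBound_le (by simp) (by positivity)).trans_eq
      (by rw [← hηε, ← add_mul, mul_right_comm]))
  · have hty := htaylor y (by simpa using hy)
    simp only [add_zero, zero_smul] at hty
    calc _ = ‖(X y (τ + h) (Y y (τ + h)) - X y (τ + h) (Y y τ + h • W y)) +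
            (X y (τ + h) (Y y τ + h • W y) - X y τ (Y y τ) - h • φ' y 0)‖ := by
          congr 1; abel
      _ ≤ _ := (norm_add_le _ _).trans (add_le_add (hlip y hy) hty)

end ODE

section Frobenius

variable {V : Type*} [NormedAddCommGroup V] [NormedSpace ℝ V] [CompleteSpace V]

theorem exists_hasDerivAt_of_lineDeriv_comm {X T : (ℝ × ℝ) × V → V} (hX : ContDiff ℝ 1 X)
    (hT : ContDiff ℝ 1 T) (hXl : LipschitzOnCompacts X.curry) (hTl : LipschitzOnCompacts T.curry)
    (comm : ∀ p, lineDeriv ℝ X p ((0, 1), T p) = lineDeriv ℝ T p ((1, 0), X p)) (y₀ : V) :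
    ∃ Y : ℝ → ℝ → V, Y 0 0 = y₀ ∧ (∀ x t, HasDerivAt (fun ξ => Y ξ t) (X ((x, t), Y x t)) x) ∧
      ∀ x t, HasDerivAt (Y x) (T ((x, t), Y x t)) t := by
  obtain ⟨Y₀, hY₀, hY₀t⟩ := (hTl.comp (φ := fun t => (0, t)) (by fun_prop)).exists_isIntegralCurve
    (hT.continuous.comp (by fun_prop)) y₀
  choose Y hY0 hYx using fun t => (hXl.comp (φ := fun x => (x, t))
    (by fun_prop)).exists_isIntegralCurve (hX.continuous.comp (by fun_prop)) (Y₀ t)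
  refine ⟨fun x t => Y t x, (hY0 0).trans hY₀, fun x t => hYx t x, fun x t => ?_⟩
  have hYc : Continuous (Y t) := (hYx t).continuous
  refine hasDerivAt_integralCurve_parameter (𝕜 := ℝ) (X := fun x t y => X ((x, t), y))
    (W := fun x => T ((x, t), Y t x))
    (φ' := fun x h => fderiv ℝ X ((x, t + h), Y t x + h • T ((x, t), Y t x))
      ((0, 1), T ((x, t), Y t x))) hXl (Eventually.of_forall hYx) (fun x h => ?_) ?_ (fun x => ?_)
    ?_ x
  · have hline : HasDerivAt (fun h : ℝ => ((x, t + h), Y t x + h • T ((x, t), Y t x)))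
        ((0, 1), T ((x, t), Y t x)) h :=
      ((hasDerivAt_const h x).prodMk ((hasDerivAt_id h).const_add t)).prodMk
        (by simpa using! ((hasDerivAt_id h).smul_const (T ((x, t), Y t x))).const_add (Y t x))
    exact (hX.differentiable one_ne_zero _).hasFDerivAt.comp_hasDerivAt h hline
  · exact ((hX.continuous_fderiv one_ne_zero).comp (by fun_prop)).clm_apply (by fun_prop)
  · have hcurve : HasDerivAt (fun ξ => ((ξ, t), Y t ξ)) ((1, 0), X ((x, t), Y t x)) x :=
      ((hasDerivAt_id x).prodMk (hasDerivAt_const x t)).prodMk (hYx t x)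
    have hdiff := comm ((x, t), Y t x)
    rw [(hX.differentiable one_ne_zero _).lineDeriv_eq_fderiv,
      (hT.differentiable one_ne_zero _).lineDeriv_eq_fderiv] at hdiff
    simp only [add_zero, zero_smul, hdiff]
    exact (hT.differentiable one_ne_zero _).hasFDerivAt.comp_hasDerivAt x hcurve
  · simpa only [hY0] using! hY₀t t

end Frobenius

section LinearEquations

variable {𝔸 : Type*} [NormedRing 𝔸]

section Real

variable [NormedAlgebra ℝ 𝔸] {M : Type*} [TopologicalSpace M]

theorem lipschitzOnCompacts_mul_add {A : M → 𝔸} (hA : Continuous A) (B : M → 𝔸) :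
    LipschitzOnCompacts fun m (y : 𝔸) => y * A m + B m :=
  .of_continuousLinearMap (L := fun m => (ContinuousLinearMap.mul ℝ 𝔸).flip (A m))
    (by fun_prop) B

theorem eq_zero_of_hasDerivAt_mul_add_mul {y A B : ℝ → 𝔸} (hA : Continuous A) (hB : Continuous B)
    (hy : ∀ x, HasDerivAt y (y x * A x + B x * y x) x) (h0 : y 0 = 0) : y = 0 := by
  let L x := (ContinuousLinearMap.mul ℝ 𝔸).flip (A x) + ContinuousLinearMap.mul ℝ 𝔸 (B x)
  have hL : LipschitzOnCompacts fun x w => L x w + 0 :=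
    .of_continuousLinearMap (by fun_prop) fun _ => 0
  refine hL.eq_of_isIntegralCurve (fun x => ?_) (fun x => ?_) h0
  · simpa [L] using hy x
  · simp [L]

theorem exists_hasDerivAt_of_zeroCurvature [CompleteSpace 𝔸] {A B A' B' : ℝ → ℝ → 𝔸}
    (hA : ContDiff ℝ 1 A.uncurry) (hB : ContDiff ℝ 1 B.uncurry)
    (hA' : ∀ x t, HasDerivAt (A x) (A' x t) t)
    (hB' : ∀ x t, HasDerivAt (fun ξ => B ξ t) (B' x t) x)
    (flat : ∀ x t, A' x t + B x t * A x t = B' x t + A x t * B x t) :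
    ∃ Y : ℝ → ℝ → 𝔸, Y 0 0 = 1 ∧ (∀ x t, HasDerivAt (fun ξ => Y ξ t) (Y x t * A x t) x) ∧
      ∀ x t, HasDerivAt (Y x) (Y x t * B x t) t := by
  refine exists_hasDerivAt_of_lineDeriv_comm (X := fun p => p.2 * A p.1.1 p.1.2)
    (T := fun p => p.2 * B p.1.1 p.1.2) (contDiff_snd.mul (hA.comp contDiff_fst))
    (contDiff_snd.mul (hB.comp contDiff_fst))
    (by simpa using! lipschitzOnCompacts_mul_add hA.continuous fun _ => 0)
    (by simpa using! lipschitzOnCompacts_mul_add hB.continuous fun _ => 0) ?_ 1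
  rintro ⟨⟨x, t⟩, y⟩
  have hline (w : 𝔸) : HasDerivAt (fun h : ℝ => y + h • w) w 0 := by
    simpa using! ((hasDerivAt_id (0 : ℝ)).smul_const w).const_add y
  have hX : HasLineDerivAt ℝ (fun p : (ℝ × ℝ) × 𝔸 => p.2 * A p.1.1 p.1.2)
      (y * B x t * A x t + y * A' x t) ((x, t), y) ((0, 1), y * B x t) := by
    have hAt : HasDerivAt (fun h => A x (t + h)) (A' x t) 0 :=
      HasDerivAt.comp_const_add t 0 (by simpa using hA' x t)
    simpa [HasLineDerivAt] using! (hline (y * B x t)).mul hAt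
  have hT : HasLineDerivAt ℝ (fun p : (ℝ × ℝ) × 𝔸 => p.2 * B p.1.1 p.1.2)
      (y * A x t * B x t + y * B' x t) ((x, t), y) ((1, 0), y * A x t) := by
    have hBx : HasDerivAt (fun h => B (x + h) t) (B' x t) 0 :=
      HasDerivAt.comp_const_add (f := fun ξ => B ξ t) x 0 (by simpa using hB' x t)
    simpa [HasLineDerivAt] using! (hline (y * A x t)).mul hBx
  rw [hX.lineDeriv, hT.lineDeriv, mul_assoc, ← mul_add, add_comm, flat, add_comm, mul_add,
    mul_assoc]

end Real

theorem differentiableAt_of_hasDerivAt_linear_pencil [NormedAlgebra ℂ 𝔸] [CompleteSpace 𝔸]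
    {A₀ A₁ : ℝ → 𝔸} (hA₀ : Continuous A₀) (hA₁ : Continuous A₁) {Y : ℝ → ℂ → 𝔸} {μ₀ : ℂ}
    (hY : ∀ᶠ μ in 𝓝 μ₀, ∀ x, HasDerivAt (fun ξ => Y ξ μ) (Y x μ * (A₀ x + μ • A₁ x)) x)
    (h0 : DifferentiableAt ℂ (Y 0) μ₀) (x : ℝ) : DifferentiableAt ℂ (Y x) μ₀ := by
  let A (m : ℝ × ℂ) := A₀ m.1 + m.2 • A₁ m.1
  have hA : Continuous A := by fun_prop
  have hYc : Continuous fun x => Y x μ₀ :=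
    continuous_iff_continuousAt.mpr fun x => (hY.self_of_nhds x).continuousAt
  obtain ⟨W, hW0, hW⟩ := (lipschitzOnCompacts_mul_add (A := fun x => A (x, μ₀)) (by fun_prop)
    fun x => Y x μ₀ * A₁ x).exists_isIntegralCurve (by fun_prop) (deriv (Y 0) μ₀)
  have hWc : Continuous W := hW.continuous
  refine (hasDerivAt_integralCurve_parameter (X := fun x μ y => y * A (x, μ)) (W := W)
    (φ' := fun x h => W x * A (x, μ₀ + h) + (Y x μ₀ + h • W x) * A₁ x)
    (by simpa using! lipschitzOnCompacts_mul_add hA fun _ => 0) hY (fun x h => ?_) (by fun_prop)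
    (fun x => by simpa using hW x) (hW0 ▸ h0.hasDerivAt) x).differentiableAt
  have hline (y w : 𝔸) : HasDerivAt (fun h : ℂ => y + h • w) w h := by
    simpa using! ((hasDerivAt_id h).smul_const w).const_add y
  have hAline : HasDerivAt (fun h => A (x, μ₀ + h)) (A₁ x) h := by
    simpa [A, add_smul, ← add_assoc] using! hline (A₀ x + μ₀ • A₁ x) (A₁ x)
  exact (hline (Y x μ₀) (W x)).mul hAline

end LinearEquations

/-! ### Lax pairs and their trivializations -/

section LaxPair

open scoped Matrix.Norms.L2Operator

theorem hasMatDerivAt_iff {n : Type*} [Finite n] {F : ℝ → Matrix n n ℂ} {F' : Matrix n n ℂ}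
    {x : ℝ} : HasMatDerivAt F F' x ↔ HasDerivAt F F' x := by
  cases nonempty_fintype n
  exact (hasDerivAt_pi.trans (forall_congr' fun _ => hasDerivAt_pi)).symm

variable {n : Type*} [Fintype n] {a b : Matrix n n ℂ} {u u' g Q Q' : ℝ → ℝ → Matrix n n ℂ}
  {E E' : ℝ → ℝ → ℂ → Matrix n n ℂ}

/-- The connection `(a l + u) dx + l⁻¹ Q dt` is flat for every `l ≠ 0` and `u(n)`-valued for
real `l`. -/
structure IsLaxPair (a : Matrix n n ℂ) (u Q : ℝ → ℝ → Matrix n n ℂ) : Prop where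
  contDiff_x : ∀ i j, ContDiff ℝ 1 fun p : ℝ × ℝ => u p.1 p.2 i j
  contDiff_t : ∀ i j, ContDiff ℝ 1 fun p : ℝ × ℝ => Q p.1 p.2 i j
  deriv_t : ∀ x t, HasDerivAt (u x) (a * Q x t - Q x t * a) t
  deriv_x : ∀ x t, HasDerivAt (fun ξ => Q ξ t) (Q x t * u x t - u x t * Q x t) x
  skew_a : aᴴ = -a
  skew_x : ∀ x t, (u x t)ᴴ = -u x t
  skew_t : ∀ x t, (Q x t)ᴴ = -Q x t

theorem IsLaxPair.continuous_x (h : IsLaxPair a u Q) : Continuous fun p : ℝ × ℝ => u p.1 p.2 :=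
  continuous_matrix fun i j => (h.contDiff_x i j).continuous

theorem IsLaxPair.continuous_t (h : IsLaxPair a u Q) : Continuous fun p : ℝ × ℝ => Q p.1 p.2 :=
  continuous_matrix fun i j => (h.contDiff_t i j).continuous

theorem IsLaxPair.continuous_potential (h : IsLaxPair a u Q) (t : ℝ) :
    Continuous fun x => u x t :=
  h.continuous_x.comp (f := fun x => (x, t)) (by fun_prop)

theorem IsLaxPair.continuous_zero_left (h : IsLaxPair a u Q) : Continuous (Q 0) :=
  h.continuous_t.comp (f := fun t => (0, t)) (by fun_prop)

variable [DecidableEq n]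

theorem contDiff_matrix {E : Type*} [NormedAddCommGroup E] [NormedSpace ℝ E] {k : WithTop ℕ∞}
    {F : E → Matrix n n ℂ} (hF : ∀ i j, ContDiff ℝ k fun p => F p i j) : ContDiff ℝ k F := by
  have hsum : F = fun p => ∑ i, ∑ j, F p i j • single i j (1 : ℂ) := by
    funext p
    simpa using matrix_eq_sum_single (F p)
  rw [hsum]
  exact ContDiff.sum fun i _ => ContDiff.sum fun j _ => (hF i j).smul contDiff_const

/-- The field `g⁻¹ b g` of a frame `g`, which drives the `t`-part of the Lax pair. -/
def frameConj (b : Matrix n n ℂ) (g : ℝ → ℝ → Matrix n n ℂ) (x t : ℝ) : Matrix n n ℂ :=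
  (g x t)⁻¹ * b * g x t

/-- `E` is the parallel frame of the connection `(a l + u) dx + l⁻¹ Q dt` with
`E(0,0,l) = 1`. -/
structure IsLaxFrame (a : Matrix n n ℂ) (u Q : ℝ → ℝ → Matrix n n ℂ)
    (E : ℝ → ℝ → ℂ → Matrix n n ℂ) : Prop where
  base : ∀ l, l ≠ 0 → E 0 0 l = 1
  deriv_x : ∀ x t l, l ≠ 0 → HasDerivAt (fun ξ => E ξ t l) (E x t l * (l • a + u x t)) x
  deriv_t : ∀ x t l, l ≠ 0 → HasDerivAt (fun τ => E x τ l) (E x t l * (l⁻¹ • Q x t)) t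

theorem isTrivialization_iff_isLaxFrame :
    IsTrivialization a b u g E ↔ IsLaxFrame a u (frameConj b g) E :=
  ⟨fun h => ⟨h.base, fun x t l hl => hasMatDerivAt_iff.mp (h.deriv_x x t l hl),
      fun x t l hl => hasMatDerivAt_iff.mp (h.deriv_t x t l hl)⟩,
    fun h => ⟨h.base, fun x t l hl => hasMatDerivAt_iff.mpr (h.deriv_x x t l hl),
      fun x t l hl => hasMatDerivAt_iff.mpr (h.deriv_t x t l hl)⟩⟩

theorem IsLaxPair.exists_isLaxFrame (h : IsLaxPair a u Q) : ∃ E, IsLaxFrame a u Q E := by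
  have hex (l : ℂ) (hl : l ≠ 0) := exists_hasDerivAt_of_zeroCurvature
    (A := fun x t => l • a + u x t) (B := fun x t => l⁻¹ • Q x t)
    (contDiff_const.add (contDiff_matrix h.contDiff_x))
    ((contDiff_matrix h.contDiff_t).const_smul l⁻¹)
    (fun x t => (h.deriv_t x t).const_add _) (fun x t => (h.deriv_x x t).const_smul l⁻¹)
    (fun x t => by
      simp only [mul_add, add_mul, smul_mul_assoc, mul_smul_comm, smul_sub,
        smul_add, inv_smul_smul₀ hl, smul_inv_smul₀ hl]
      abel)
  choose! Y hY0 hYx hYt using hex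
  exact ⟨fun x t l => Y l x t, hY0, fun x t l hl => hYx l hl x t, fun x t l hl => hYt l hl x t⟩

theorem IsLaxFrame.mul_eq_mul_of_gauge (hE : IsLaxFrame a u Q E) (hE' : IsLaxFrame a u' Q' E')
    (h : IsLaxPair a u Q) {l : ℂ} (hl : l ≠ 0) {M : ℝ → ℝ → Matrix n n ℂ}
    (hMx : ∀ x t, HasDerivAt (fun ξ => M ξ t)
      (M x t * (l • a + u x t) - (l • a + u' x t) * M x t) x)
    (hMt : ∀ x t, HasDerivAt (M x) (M x t * (l⁻¹ • Q x t) - (l⁻¹ • Q' x t) * M x t) t) (x t : ℝ) :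
    E' x t l * M x t = M 0 0 * E x t l := by
  have hu := h.continuous_potential t
  have hQ := h.continuous_zero_left
  have hzero : (fun τ => E' 0 τ l * M 0 τ - M 0 0 * E 0 τ l) = 0 := by
    refine eq_zero_of_hasDerivAt_mul_add_mul (A := fun τ => l⁻¹ • Q 0 τ) (B := 0)
      (by fun_prop) continuous_const (fun τ => ?_) (by simp [hE.base l hl, hE'.base l hl])
    refine (((hE'.deriv_t 0 τ l hl).mul (hMt 0 τ)).sub
      ((hE.deriv_t 0 τ l hl).const_mul (M 0 0))).congr_deriv ?_
    simp only [Pi.zero_apply]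
    generalize l⁻¹ • Q 0 τ = B
    generalize l⁻¹ • Q' 0 τ = B'
    noncomm_ring
  refine sub_eq_zero.mp (congrFun (eq_zero_of_hasDerivAt_mul_add_mul
    (y := fun ξ => E' ξ t l * M ξ t - M 0 0 * E ξ t l) (A := fun ξ => l • a + u ξ t) (B := 0)
    (by fun_prop) continuous_const (fun ξ => ?_) (congrFun hzero t)) x)
  refine (((hE'.deriv_x ξ t l hl).mul (hMx ξ t)).sub
    ((hE.deriv_x ξ t l hl).const_mul (M 0 0))).congr_deriv ?_
  simp only [Pi.zero_apply]
  generalize l • a + u ξ t = A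
  generalize l • a + u' ξ t = A'
  noncomm_ring

theorem IsLaxFrame.unique (hE : IsLaxFrame a u Q E) (hE' : IsLaxFrame a u Q E')
    (h : IsLaxPair a u Q) (x t : ℝ) {l : ℂ} (hl : l ≠ 0) : E' x t l = E x t l := by
  simpa using hE.mul_eq_mul_of_gauge hE' h hl (M := fun _ _ => 1)
    (fun x t => by simpa using hasDerivAt_const x (1 : Matrix n n ℂ))
    (fun x t => by simpa using hasDerivAt_const t (1 : Matrix n n ℂ)) x t

theorem IsLaxFrame.mul_conjTranspose (hE : IsLaxFrame a u Q E) (h : IsLaxPair a u Q) (x t : ℝ)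
    {l : ℂ} (hl : l ≠ 0) : E x t l * (E x t (star l))ᴴ = 1 := by
  have hl' : star l ≠ 0 := star_ne_zero.mpr hl
  have hx (ξ τ : ℝ) : HasDerivAt (fun ξ => E ξ τ l * (E ξ τ (star l))ᴴ) 0 ξ := by
    have hskew : (star l • a + u ξ τ)ᴴ = -(l • a + u ξ τ) := by
      simp [h.skew_a, h.skew_x, add_comm]
    refine ((hE.deriv_x ξ τ l hl).mul (hE.deriv_x ξ τ _ hl').star).congr_deriv ?_
    rw [star_mul, star_eq_conjTranspose, star_eq_conjTranspose, hskew]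
    rw [neg_mul, mul_neg, mul_assoc, add_neg_cancel]
  have ht (ξ τ : ℝ) : HasDerivAt (fun τ => E ξ τ l * (E ξ τ (star l))ᴴ) 0 τ := by
    have hskew : ((star l)⁻¹ • Q ξ τ)ᴴ = -(l⁻¹ • Q ξ τ) := by
      simp [h.skew_t, conjTranspose_smul]
    refine ((hE.deriv_t ξ τ l hl).mul (hE.deriv_t ξ τ _ hl').star).congr_deriv ?_
    rw [star_mul, star_eq_conjTranspose, star_eq_conjTranspose, hskew]
    simp [mul_assoc]
  calc E x t l * (E x t (star l))ᴴ = E 0 t l * (E 0 t (star l))ᴴ :=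
        is_const_of_deriv_eq_zero (fun ξ => (hx ξ t).differentiableAt) (fun ξ => (hx ξ t).deriv) x 0
    _ = E 0 0 l * (E 0 0 (star l))ᴴ :=
        is_const_of_deriv_eq_zero (fun τ => (ht 0 τ).differentiableAt) (fun τ => (ht 0 τ).deriv) t 0
    _ = 1 := by rw [hE.base l hl, hE.base _ hl', conjTranspose_one, one_mul]

theorem IsLaxFrame.differentiableAt (hE : IsLaxFrame a u Q E) (h : IsLaxPair a u Q) (x t : ℝ)
    {l : ℂ} (hl : l ≠ 0) : DifferentiableAt ℂ (E x t) l := by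
  have hne : ∀ᶠ μ in 𝓝 l, μ ≠ 0 := isOpen_ne.eventually_mem hl
  have hne' : ∀ᶠ μ in 𝓝 l⁻¹, μ ≠ 0 := isOpen_ne.eventually_mem (inv_ne_zero hl)
  -- Along `x = 0` the equation is linear in `l⁻¹`.
  have h0 : DifferentiableAt ℂ (fun μ => E 0 t μ⁻¹) l⁻¹ := by
    refine differentiableAt_of_hasDerivAt_linear_pencil (A₀ := 0) continuous_const
      h.continuous_zero_left (Y := fun τ μ => E 0 τ μ⁻¹) ?_ ?_ t
    · filter_upwards [hne'] with μ hμ τ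
      simpa using hE.deriv_t 0 τ μ⁻¹ (inv_ne_zero hμ)
    · refine (differentiableAt_const (1 : Matrix n n ℂ)).congr_of_eventuallyEq ?_
      filter_upwards [hne'] with μ hμ using hE.base _ (inv_ne_zero hμ)
  refine differentiableAt_of_hasDerivAt_linear_pencil (h.continuous_potential t)
    (continuous_const (y := a)) (Y := fun ξ μ => E ξ t μ) ?_ ?_ x
  · filter_upwards [hne] with μ hμ ξ
    simpa [add_comm] using hE.deriv_x ξ t μ hμ
  · simpa [Function.comp_def] using h0.comp l (differentiableAt_inv hl)

theorem IsLaxFrame.isPlusLoop (hE : IsLaxFrame a u Q E) (h : IsLaxPair a u Q) (x t : ℝ) :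
    IsPlusLoop (E x t) where
  holomorphic i j _ hl := (differentiableAt_pi.mp (differentiableAt_pi.mp
    (hE.differentiableAt h x t hl) i) j).differentiableWithinAt
  invertible _ hl := (isUnit_iff_isUnit_det _).mp
    (IsUnit.of_mul_eq_one _ (hE.mul_conjTranspose h x t hl))
  reality _ hl := mul_eq_one_comm.mp (hE.mul_conjTranspose h x t hl)

end LaxPair

/-! ### Uniqueness of the Birkhoff factorization -/

section Birkhoff

variable {f : ℂ → ℂ} {c z : ℂ}

theorem exists_tendsto_of_meromorphicAt_of_frequently_norm_le (hf : MeromorphicAt f z) {C : ℝ}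
    (hC : ∃ᶠ l in 𝓝[≠] z, ‖f l‖ ≤ C) : ∃ c, Tendsto f (𝓝[≠] z) (𝓝 c) := by
  rw [tendsto_nhds_iff_meromorphicOrderAt_nonneg hf, ← not_lt,
    ← tendsto_cobounded_iff_meromorphicOrderAt_neg hf, ← tendsto_norm_atTop_iff_cobounded]
  intro hinf
  obtain ⟨l, hle, hlt⟩ := (hC.and_eventually (hinf.eventually_gt_atTop C)).exists
  exact hlt.not_ge hle

theorem eq_of_tendsto_cocompact_of_tendsto_nhdsNE (hf : DifferentiableOn ℂ f {z}ᶜ) {w : ℂ}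
    (hw : Tendsto f (𝓝[≠] z) (𝓝 w)) (hc : Tendsto f (cocompact ℂ) (𝓝 c)) {l : ℂ} (hl : l ≠ z) :
    f l = c := by
  set F := Function.update f z w
  have hFf {l : ℂ} (hl : l ≠ z) : F l = f l := Function.update_of_ne hl _ _
  have hF : DifferentiableOn ℂ F {z}ᶜ := hf.congr fun l hl => hFf hl
  have hFd : Differentiable ℂ F := differentiableOn_univ.mp <|
    (Complex.differentiableOn_compl_singleton_and_continuousAt_iff univ_mem).mp
      ⟨by rwa [← Set.compl_eq_univ_sdiff], continuousAt_update_same.mpr hw⟩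
  have hFc : Tendsto F (cocompact ℂ) (𝓝 c) := by
    refine hc.congr' ?_
    filter_upwards [cocompact_le_cofinite (Set.finite_singleton z).compl_mem_cofinite]
      with l hl using (hFf hl).symm
  rw [← hFf hl, hFd.apply_eq_of_tendsto_cocompact l hFc]

theorem meromorphicAt_of_eventuallyEq_div {d p : Polynomial ℂ} (hd : d ≠ 0)
    (h : ∀ l, d.eval l ≠ 0 → f l = p.eval l / d.eval l) (z : ℂ) : MeromorphicAt f z := by
  have hdiv : MeromorphicAt (fun l => p.eval l / d.eval l) z :=
    (p.differentiable.analyticAt z).meromorphicAt.fun_div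
      (d.differentiable.analyticAt z).meromorphicAt
  refine hdiv.congr ?_
  filter_upwards [nhdsNE_le_cofinite z (Polynomial.finite_setOfPred_isRoot hd).compl_mem_cofinite]
    with l hl using (h l hl).symm

variable {n : Type*} [Fintype n] [DecidableEq n] {F G m k : ℂ → Matrix n n ℂ}

theorem IsRationalLoop.meromorphicAt (hm : IsRationalLoop m) (i j : n) (z : ℂ) :
    MeromorphicAt (fun l => m l i j) z := by
  obtain ⟨d, P, hd, h⟩ := hm.rational
  exact meromorphicAt_of_eventuallyEq_div hd (fun l hl => h l hl i j) z

theorem IsRationalLoop.conjTranspose (hm : IsRationalLoop m) :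
    IsRationalLoop fun l => (m (star l))ᴴ where
  rational := by
    obtain ⟨d, P, hd, h⟩ := hm.rational
    have heval (p : Polynomial ℂ) (l : ℂ) :
        (p.map (starRingEnd ℂ)).eval l = star (p.eval (star l)) := by
      rw [Polynomial.eval_map, ← starRingEnd_apply, ← Polynomial.eval₂_at_apply]
      simp
    refine ⟨d.map (starRingEnd ℂ), fun i j => (P j i).map (starRingEnd ℂ),
      (Polynomial.map_ne_zero_iff (starRingEnd ℂ).injective).mpr hd, fun l hl i j => ?_⟩
    rw [heval] at hl ⊢
    rw [heval, conjTranspose_apply, h _ (star_ne_zero.mp hl), star_div₀]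
  at_infinity := by
    have hstar : Tendsto (fun l : ℂ => star l) (cocompact ℂ) (cocompact ℂ) :=
      Complex.conjLIE.toHomeomorph.isClosedEmbedding.tendsto_cocompact
    simpa [Function.comp_def] using
      (continuous_id.matrix_conjTranspose.tendsto _).comp (hm.at_infinity.comp hstar)
  reality := by
    filter_upwards [hm.reality] with l hl
    rw [conjTranspose_conjTranspose, star_star]
    exact mul_eq_one_comm.mp hl

theorem IsPlusLoop.mul_conjTranspose (hF : IsPlusLoop F) {l : ℂ} (hl : l ≠ 0) :
    F l * (F (star l))ᴴ = 1 :=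
  mul_eq_one_comm.mp (hF.reality l hl)

theorem IsPlusLoop.conjTranspose_mul (hG : IsPlusLoop G) (hF : IsPlusLoop F) :
    IsPlusLoop fun l => (G (star l))ᴴ * F l where
  holomorphic i j l hl := by
    have hstar : star l ≠ 0 := star_ne_zero.mpr hl
    have hG' (p : n) : DifferentiableAt ℂ (fun l => star (G (star l) p i)) l := by
      simpa [Function.comp_def] using (((hG.holomorphic p i).differentiableAt
        (isOpen_compl_singleton.mem_nhds hstar))).star_star
    simp only [mul_apply, conjTranspose_apply]
    exact (DifferentiableAt.fun_sum fun p _ => (hG' p).mul ((hF.holomorphic p j).differentiableAt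
      (isOpen_compl_singleton.mem_nhds hl))).differentiableWithinAt
  invertible l hl := by
    rw [det_mul, det_conjTranspose]
    exact (hG.invertible _ (star_ne_zero.mpr hl)).star.mul (hF.invertible l hl)
  reality l hl := by
    rw [Matrix.conjTranspose_mul, conjTranspose_conjTranspose, star_star, mul_assoc,
      ← mul_assoc (G l), hG.mul_conjTranspose hl, one_mul, hF.reality l hl]

/-- On the real axis a plus loop is unitary, so its singularity at `0` is removable. -/
theorem IsPlusLoop.eq_one (hF : IsPlusLoop F) (h0 : ∀ i j, MeromorphicAt (fun l => F l i j) 0)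
    (hinf : Tendsto F (cocompact ℂ) (𝓝 1)) {l : ℂ} (hl : l ≠ 0) : F l = 1 := by
  have hreal (r : ℝ) (hr : r ≠ 0) (i j : n) : ‖F r i j‖ ≤ 1 :=
    entry_norm_bound_of_unitary (mem_unitaryGroup_iff'.mpr <| by
      simpa [star_eq_conjTranspose] using hF.reality r (Complex.ofReal_ne_zero.mpr hr)) i j
  have hfreq (i j : n) : ∃ᶠ l in 𝓝[≠] (0 : ℂ), ‖F l i j‖ ≤ 1 := by
    have hcoe : Tendsto (fun r : ℝ => (r : ℂ)) (𝓝[≠] 0) (𝓝[≠] 0) := by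
      simpa using Complex.continuous_ofReal.continuousWithinAt.tendsto_nhdsWithin (x := 0)
        (s := {0}ᶜ) (t := {0}ᶜ) fun r hr => Complex.ofReal_ne_zero.mpr hr
    refine hcoe.frequently (Eventually.frequently ?_)
    filter_upwards [self_mem_nhdsWithin] with r hr using hreal r hr i j
  ext i j
  obtain ⟨w, hw⟩ := exists_tendsto_of_meromorphicAt_of_frequently_norm_le (h0 i j) (hfreq i j)
  exact eq_of_tendsto_cocompact_of_tendsto_nhdsNE (hF.holomorphic i j) hw
    (tendsto_pi_nhds.mp (tendsto_pi_nhds.mp hinf i) j) hl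

theorem IsPlusLoop.eq_of_factorization (hF : IsPlusLoop F) (hG : IsPlusLoop G)
    (hm : IsRationalLoop m) (hk : IsRationalLoop k)
    (h : ∀ᶠ l in cofinite, F l * m l = G l * k l) {l : ℂ} (hl : l ≠ 0) : F l = G l := by
  have hquot : ∀ᶠ l in cofinite, k l * (m (star l))ᴴ = (G (star l))ᴴ * F l := by
    filter_upwards [h, hm.reality, (Set.finite_singleton (0 : ℂ)).compl_mem_cofinite]
      with l hfac hreal hne
    calc k l * (m (star l))ᴴ = (G (star l))ᴴ * (G l * k l) * (m (star l))ᴴ := by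
          rw [← mul_assoc (G _)ᴴ, hG.reality l hne, one_mul]
      _ = (G (star l))ᴴ * F l := by
          rw [← hfac, mul_assoc, mul_assoc, mul_eq_one_comm.mp hreal, mul_one]
  have hone : (G (star l))ᴴ * F l = 1 := by
    refine (hG.conjTranspose_mul hF).eq_one (fun i j => ?_) ?_ hl
    · have hmer : MeromorphicAt (fun l => ∑ p, k l i p * (m (star l))ᴴ p j) 0 :=
        MeromorphicAt.fun_sum fun p _ =>
          (hk.meromorphicAt i p 0).fun_mul (hm.conjTranspose.meromorphicAt p j 0)
      refine hmer.congr ?_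
      filter_upwards [nhdsNE_le_cofinite 0 hquot] with l hl
      rw [← hl, mul_apply]
    · simpa using (hk.at_infinity.mul hm.conjTranspose.at_infinity).congr'
        (cocompact_le_cofinite hquot)
  rw [← mul_one (G l), ← hone, ← mul_assoc, hG.mul_conjTranspose hl, one_mul]

variable {a b : Matrix n n ℂ} {u g v v' : ℝ → ℝ → Matrix n n ℂ}

theorem IsDressing.unique (hv : IsDressing a b u g k v) (hv' : IsDressing a b u g k v')
    (h : IsLaxPair a u (frameConj b g)) : v = v' := by
  obtain ⟨E, F, m, hE, hF, hm, hfac, hFx⟩ := hv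
  obtain ⟨E', F', m', hE', hF', hm', hfac', hFx'⟩ := hv'
  rw [isTrivialization_iff_isLaxFrame] at hE hE'
  have heq (x t : ℝ) : F x t 1 = F' x t 1 := by
    refine (hF x t).eq_of_factorization (hF' x t) (hm x t) (hm' x t) ?_ one_ne_zero
    filter_upwards [hfac x t, hfac' x t, (Set.finite_singleton (0 : ℂ)).compl_mem_cofinite]
      with l hl hl' hne
    rw [← hl, ← hl', hE.unique hE' h x t hne]
  funext x t
  have hx := hFx x t 1 one_ne_zero
  simp only [heq] at hx
  have hmul : F' x t 1 * ((1 : ℂ) • a + v x t) = F' x t 1 * ((1 : ℂ) • a + v' x t) :=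
    Matrix.ext fun i j => (hx i j).unique (hFx' x t 1 one_ne_zero i j)
  exact add_left_cancel (((isUnit_iff_isUnit_det _).mpr
    ((hF' x t).invertible 1 one_ne_zero)).mul_left_cancel hmul)

end Birkhoff

/-! ### Simple elements -/

section SimpleElement

variable {n : Type*} [DecidableEq n] {P : Matrix n n ℂ} {z l : ℂ}

theorem conjTranspose_simpleElement (hP : IsSelfAdjoint P) :
    (simpleElement z P (star l))ᴴ = simpleElement (star z) P l := by
  have hPH : Pᴴ = P := hP
  simp only [simpleElement, conjTranspose_add, conjTranspose_smul, conjTranspose_sub,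
    conjTranspose_one, hPH, star_div₀, star_sub, star_star]

theorem transpose_simpleElement (hP : P.IsSymm) (hz : star z = -z) :
    (simpleElement z P (-l))ᵀ = simpleElement (star z) P l := by
  have hdiv : (-l - z) / (-l - star z) = (l - star z) / (l - star (star z)) := by
    rw [star_star, hz, ← neg_div_neg_eq]
    ring
  simp only [simpleElement, transpose_add, transpose_smul, transpose_sub, transpose_one, hP.eq,
    hdiv]

/-- The polynomial `(l - conj z) g_{z,P}(l)`, without the pole of the simple element. -/
def simplePencil (z : ℂ) (P : Matrix n n ℂ) (l : ℂ) : Matrix n n ℂ :=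
  (l - z) • 1 + (z - star z) • P

theorem smul_simpleElement (hl : l ≠ star z) :
    (l - star z) • simpleElement z P l = simplePencil z P l := by
  rw [simpleElement, simplePencil, smul_add, smul_smul, mul_div_cancel₀ _ (sub_ne_zero.mpr hl)]
  module

theorem tendsto_simpleElement (z : ℂ) (P : Matrix n n ℂ) :
    Tendsto (simpleElement z P) (cocompact ℂ) (𝓝 1) := by
  have hinv : Tendsto (fun l : ℂ => (l - star z)⁻¹) (cocompact ℂ) (𝓝 0) := by
    rw [← Metric.cobounded_eq_cocompact]
    exact tendsto_inv₀_cobounded.comp (by simp [sub_eq_add_neg])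
  have hlim := ((hinv.const_mul (star z - z)).const_add 1).smul_const (1 - P) |>.const_add P
  rw [mul_zero, add_zero, one_smul, add_sub_cancel] at hlim
  refine hlim.congr' ?_
  filter_upwards [cocompact_le_cofinite (Set.finite_singleton (star z)).compl_mem_cofinite]
    with l hl
  have hne : l - star z ≠ 0 := sub_ne_zero.mpr hl
  rw [simpleElement, show (l - z) / (l - star z) = 1 + (star z - z) * (l - star z)⁻¹ by
    field_simp; ring]

variable [Fintype n]

theorem simpleElement_star_mul_simpleElement (hP : IsIdempotentElem P) (hl : l ≠ z)
    (hl' : l ≠ star z) : simpleElement (star z) P l * simpleElement z P l = 1 := by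
  simp only [simpleElement, star_star, add_mul, mul_add, smul_mul_assoc, mul_smul_comm,
    hP.eq, hP.mul_one_sub_self, hP.one_sub_mul_self, hP.one_sub.eq, smul_zero, add_zero, zero_add,
    smul_smul]
  rw [div_mul_div_cancel₀ (sub_ne_zero.mpr hl'), div_self (sub_ne_zero.mpr hl), one_smul,
    add_sub_cancel]

theorem simplePencil_mul_sub_mul_simplePencil (hP : IsIdempotentElem P) (hz : z ≠ 0) (hl : l ≠ 0)
    (Q : Matrix n n ℂ) :
    simplePencil z P l * (l⁻¹ • Q) -
        (l⁻¹ • (simpleElement z P 0 * Q * simpleElement (star z) P 0)) * simplePencil z P l =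
      Q - simpleElement z P 0 * Q * simpleElement (star z) P 0 := by
  have hz' : (0 : ℂ) ≠ star z := (star_ne_zero.mpr hz).symm
  have hinv := simpleElement_star_mul_simpleElement hP hz.symm hz'
  have hpencil : simplePencil z P l = l • 1 + (0 - star z) • simpleElement z P 0 := by
    rw [smul_simpleElement hz', simplePencil, simplePencil]
    module
  rw [hpencil]
  simp only [add_mul, mul_add, smul_mul_assoc, mul_smul_comm, mul_one, one_mul, hinv, mul_assoc,
    smul_smul]
  match_scalars <;> field_simp
  ring

theorem sub_simpleElement_conj (hz : z ≠ 0) (Q : Matrix n n ℂ) :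
    Q - simpleElement z P 0 * Q * simpleElement (star z) P 0 =
      (z - star z) • (((‖z‖ ^ 2 : ℝ) : ℂ)⁻¹ •
        ((z - star z) • (P * Q * P) - z • (Q * P) + star z • (P * Q))) := by
  have hnorm : ((‖z‖ ^ 2 : ℝ) : ℂ) = z * star z := by
    rw [← Complex.normSq_eq_norm_sq, Complex.normSq_eq_conj_mul_self, mul_comm, starRingEnd_apply]
  have hz' : star z ≠ 0 := star_ne_zero.mpr hz
  simp only [hnorm, simpleElement, star_star, mul_add, add_mul, mul_sub, sub_mul, smul_mul_assoc,
    mul_smul_comm, mul_one, one_mul]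
  match_scalars <;> field_simp <;> ring

theorem isRationalLoop_simpleElement (hP : IsStarProjection P) (z : ℂ) :
    IsRationalLoop (simpleElement z P) where
  rational := by
    refine ⟨Polynomial.X - Polynomial.C (star z), of fun i j =>
      (Polynomial.X - Polynomial.C z) * Polynomial.C ((1 : Matrix n n ℂ) i j) +
        Polynomial.C ((z - star z) * P i j), Polynomial.X_sub_C_ne_zero _, fun l hl i j => ?_⟩
    have hne : l - star z ≠ 0 := by simpa using hl
    have hpencil := congrFun₂ (smul_simpleElement (P := P) (sub_ne_zero.mp hne)) i j
    simp only [simplePencil, Matrix.add_apply, Matrix.smul_apply, smul_eq_mul] at hpencil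
    rw [eq_div_iff (by simpa using hl), mul_comm]
    simpa using hpencil
  at_infinity := tendsto_simpleElement z P
  reality := by
    filter_upwards [eventually_cofinite_ne z, eventually_cofinite_ne (star z)] with l hl hl'
    rw [conjTranspose_simpleElement hP.isSelfAdjoint,
      simpleElement_star_mul_simpleElement hP.isIdempotentElem hl hl']

theorem isTwistedRationalLoop_simpleElement (hP : IsStarProjection P) (hPT : P.IsSymm)
    (hz : star z = -z) : IsTwistedRationalLoop (simpleElement z P) where
  toIsRationalLoop := isRationalLoop_simpleElement hP z
  twisted := by
    filter_upwards [eventually_cofinite_ne z, eventually_cofinite_ne (star z)] with l hl hl'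
    rw [transpose_simpleElement hPT hz,
      simpleElement_star_mul_simpleElement hP.isIdempotentElem hl hl']

theorem IsHermitianProjectionOnto.isStarProjection {V : Submodule ℂ (n → ℂ)}
    (hP : IsHermitianProjectionOnto P V) : IsStarProjection P :=
  ⟨hP.idempotent, hP.hermitian⟩

end SimpleElement

section ProjectionSystem

open scoped Matrix.Norms.L2Operator

variable {n : Type*} [Fintype n] [DecidableEq n] {a b p : Matrix n n ℂ} {z : ℂ}
  {u g P P' : ℝ → ℝ → Matrix n n ℂ} {E E' : ℝ → ℝ → ℂ → Matrix n n ℂ}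

/-- The potential `u + (z - conj z) [P, a]` of the dressed connection. -/
def dressedPotential (a : Matrix n n ℂ) (z : ℂ) (P u : ℝ → ℝ → Matrix n n ℂ) (x t : ℝ) :
    Matrix n n ℂ :=
  u x t + (z - star z) • (P x t * a - a * P x t)

/-- The `t`-part `k Q k⁻¹`, `k = g_{z,P}(0)`, of the dressed connection; the inverse of `k` is
written as `g_{conj z,P}(0)`. -/
def dressedField (z : ℂ) (P Q : ℝ → ℝ → Matrix n n ℂ) (x t : ℝ) : Matrix n n ℂ :=
  simpleElement z (P x t) 0 * Q x t * simpleElement (star z) (P x t) 0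

theorem IsProjectionSystem.isStarProjection (hP : IsProjectionSystem a b u g z p P) (x t : ℝ) :
    IsStarProjection (P x t) :=
  ⟨hP.idempotent x t, hP.hermitian x t⟩

theorem IsProjectionSystem.hasDerivAt_x (hP : IsProjectionSystem a b u g z p P) (x t : ℝ) :
    HasDerivAt (fun ξ => P ξ t) ((star z - z) • ((P x t * a - a * P x t) * P x t)
      - ((z • a + u x t) * P x t - P x t * (z • a + u x t))) x :=
  hasMatDerivAt_iff.mp (hP.deriv_x x t)

theorem IsProjectionSystem.hasDerivAt_t (hP : IsProjectionSystem a b u g z p P) (x t : ℝ) :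
    HasDerivAt (P x) (((‖z‖ ^ 2 : ℝ) : ℂ)⁻¹ •
      ((z - star z) • (P x t * frameConj b g x t * P x t) - z • (frameConj b g x t * P x t)
        + star z • (P x t * frameConj b g x t))) t :=
  hasMatDerivAt_iff.mp (hP.deriv_t x t)

theorem IsProjectionSystem.hasDerivAt_simplePencil_x (hP : IsProjectionSystem a b u g z p P)
    (x t : ℝ) (l : ℂ) : HasDerivAt (fun ξ => simplePencil z (P ξ t) l)
      (simplePencil z (P x t) l * (l • a + u x t)
        - (l • a + dressedPotential a z P u x t) * simplePencil z (P x t) l) x := by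
  refine (((hP.hasDerivAt_x x t).const_smul (z - star z)).const_add _).congr_deriv ?_
  simp only [simplePencil, dressedPotential, mul_add, add_mul, sub_mul, smul_mul_assoc,
    mul_smul_comm, one_mul, mul_one]
  module

theorem IsProjectionSystem.hasDerivAt_simplePencil_t (hP : IsProjectionSystem a b u g z p P)
    (hz : z ≠ 0) (x t : ℝ) {l : ℂ} (hl : l ≠ 0) :
    HasDerivAt (fun τ => simplePencil z (P x τ) l)
      (simplePencil z (P x t) l * (l⁻¹ • frameConj b g x t)
        - (l⁻¹ • dressedField z P (frameConj b g) x t) * simplePencil z (P x t) l) t := by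
  refine (((hP.hasDerivAt_t x t).const_smul (z - star z)).const_add _).congr_deriv ?_
  rw [dressedField, simplePencil_mul_sub_mul_simplePencil
    (hP.isStarProjection x t).isIdempotentElem hz hl, sub_simpleElement_conj hz]

theorem IsProjectionSystem.gauge (hP : IsProjectionSystem a b u g z p P) (hz : z ≠ 0)
    (h : IsLaxPair a u (frameConj b g)) (hE : IsLaxFrame a u (frameConj b g) E)
    (hE' : IsLaxFrame a (dressedPotential a z P u) (dressedField z P (frameConj b g)) E')
    (x t : ℝ) {l : ℂ} (hl : l ≠ 0) :
    E' x t l * simplePencil z (P x t) l = simplePencil z p l * E x t l := by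
  simpa only [hP.base] using hE.mul_eq_mul_of_gauge hE' h hl
    (fun x t => hP.hasDerivAt_simplePencil_x x t l)
    (fun x t => hP.hasDerivAt_simplePencil_t hz x t hl) x t

theorem IsProjectionSystem.isDressing (hP : IsProjectionSystem a b u g z p P) (hz : z ≠ 0)
    (h : IsLaxPair a u (frameConj b g))
    (h' : IsLaxPair a (dressedPotential a z P u) (dressedField z P (frameConj b g))) :
    IsDressing a b u g (simpleElement z p) (dressedPotential a z P u) := by
  obtain ⟨E, hE⟩ := h.exists_isLaxFrame
  obtain ⟨E', hE'⟩ := h'.exists_isLaxFrame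
  refine ⟨E, E', fun x t => simpleElement z (P x t), isTrivialization_iff_isLaxFrame.mpr hE,
    hE'.isPlusLoop h', fun x t => isRationalLoop_simpleElement (hP.isStarProjection x t) z,
    fun x t => ?_, fun x t l hl => hasMatDerivAt_iff.mpr (hE'.deriv_x x t l hl)⟩
  filter_upwards [eventually_cofinite_ne 0, eventually_cofinite_ne (star z)] with l hl hlz
  have hgauge := hP.gauge hz h hE hE' x t hl
  rw [← smul_simpleElement hlz, ← smul_simpleElement hlz, mul_smul_comm, smul_mul_assoc] at hgauge
  exact (smul_right_injective _ (sub_ne_zero.mpr hlz) hgauge).symm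

theorem IsProjectionSystem.isHermitianProjectionOnto (hP : IsProjectionSystem a b u g z p P)
    (hz : z ≠ 0) (hz' : z ≠ star z) (h : IsLaxPair a u (frameConj b g))
    (h' : IsLaxPair a (dressedPotential a z P u) (dressedField z P (frameConj b g)))
    (hE : IsLaxFrame a u (frameConj b g) E) (x t : ℝ) :
    IsHermitianProjectionOnto (P x t)
      ((LinearMap.range (toLin' p)).map (toLin' (E x t z)ᴴ)) := by
  obtain ⟨E', hE'⟩ := h'.exists_isLaxFrame
  have hgauge : E' x t z * P x t = p * E x t z := by
    have hpencil := hP.gauge hz h hE hE' x t hz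
    simp only [simplePencil, sub_self, zero_smul, zero_add, mul_smul_comm, smul_mul_assoc]
      at hpencil
    exact smul_right_injective _ (sub_ne_zero.mpr hz') hpencil
  have hadj : P x t * (E' x t z)ᴴ = (E x t z)ᴴ * p := by
    have hp : pᴴ = p := hP.base ▸ hP.hermitian 0 0
    simpa [hp, hP.hermitian x t] using congrArg conjTranspose hgauge
  have hunit : IsUnit (E' x t z)ᴴ := (isUnit_conjTranspose _).mpr <|
    (isUnit_iff_isUnit_det _).mpr ((hE'.isPlusLoop h' x t).invertible z hz)
  have hsurj : LinearMap.range (toLin' (E' x t z)ᴴ) = ⊤ :=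
    LinearMap.range_eq_top.mpr (mulVec_surjective_iff_isUnit.mpr hunit)
  refine ⟨hP.hermitian x t, hP.idempotent x t, ?_⟩
  rw [← LinearMap.range_comp, ← toLin'_mul, ← hadj, toLin'_mul, LinearMap.range_comp, hsurj,
    Submodule.map_top]

theorem IsProjectionSystem.unique (hP : IsProjectionSystem a b u g z p P)
    (hP' : IsProjectionSystem a b u g z p P') (h : IsLaxPair a u (frameConj b g)) : P = P' := by
  have hQ := h.continuous_zero_left
  have hPt : Continuous (P 0) :=
    continuous_iff_continuousAt.mpr fun t => (hP.hasDerivAt_t 0 t).continuousAt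
  have hPt' : Continuous (P' 0) :=
    continuous_iff_continuousAt.mpr fun t => (hP'.hasDerivAt_t 0 t).continuousAt
  have hzero : (fun t => P 0 t - P' 0 t) = 0 := by
    refine eq_zero_of_hasDerivAt_mul_add_mul
      (A := fun t => ((‖z‖ ^ 2 : ℝ) : ℂ)⁻¹ •
        ((z - star z) • (frameConj b g 0 t * P 0 t) + star z • frameConj b g 0 t))
      (B := fun t => ((‖z‖ ^ 2 : ℝ) : ℂ)⁻¹ •
        ((z - star z) • (P' 0 t * frameConj b g 0 t) - z • frameConj b g 0 t))
      (by fun_prop) (by fun_prop)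
      (fun t => ((hP.hasDerivAt_t 0 t).sub (hP'.hasDerivAt_t 0 t)).congr_deriv ?_)
      (by simp [hP.base, hP'.base])
    simp only [mul_add, mul_sub, sub_mul, smul_mul_assoc, mul_smul_comm, mul_assoc]
    module
  funext x t
  have hu := h.continuous_potential t
  have hPx : Continuous fun ξ => P ξ t :=
    continuous_iff_continuousAt.mpr fun ξ => (hP.hasDerivAt_x ξ t).continuousAt
  have hPx' : Continuous fun ξ => P' ξ t :=
    continuous_iff_continuousAt.mpr fun ξ => (hP'.hasDerivAt_x ξ t).continuousAt
  refine sub_eq_zero.mp (congrFun (eq_zero_of_hasDerivAt_mul_add_mul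
    (y := fun ξ => P ξ t - P' ξ t)
    (A := fun ξ => (star z - z) • (a * P ξ t) + (z • a + u ξ t))
    (B := fun ξ => (star z - z) • (P' ξ t * a - a) - (z • a + u ξ t))
    (by fun_prop) (by fun_prop)
    (fun ξ => ((hP.hasDerivAt_x ξ t).sub (hP'.hasDerivAt_x ξ t)).congr_deriv ?_)
    (congrFun hzero t)) x)
  simp only [mul_add, add_mul, mul_sub, sub_mul, smul_mul_assoc, mul_smul_comm, mul_assoc,
    hP.idempotent ξ t, hP'.idempotent ξ t]
  module

end ProjectionSystem

/-! ### The sine-Gordon equation and its Bäcklund transform -/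

section PartialDerivatives

variable {F : Type*} [NormedAddCommGroup F] [NormedSpace ℝ F] {f f₁ f₂ : ℝ → ℝ → F}
  {k l : WithTop ℕ∞}

theorem differentiable_fst (hf : ContDiff ℝ l fun p : ℝ × ℝ => f p.1 p.2) (hl : l ≠ 0) (t : ℝ) :
    Differentiable ℝ fun x => f x t :=
  (hf.comp (contDiff_id.prodMk contDiff_const)).differentiable hl

theorem differentiable_snd (hf : ContDiff ℝ l fun p : ℝ × ℝ => f p.1 p.2) (hl : l ≠ 0) (x : ℝ) :
    Differentiable ℝ (f x) :=
  (hf.comp (contDiff_const.prodMk contDiff_id)).differentiable hl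

theorem contDiff_deriv_fst (hf : ContDiff ℝ l fun p : ℝ × ℝ => f p.1 p.2) (hkl : k + 1 ≤ l) :
    ContDiff ℝ k fun p : ℝ × ℝ => deriv (fun y => f y p.2) p.1 := by
  have hl : l ≠ 0 := by rintro rfl; simp at hkl
  convert (hf.fderiv_right hkl).clm_apply (contDiff_const (c := ((1 : ℝ), (0 : ℝ)))) using 2 with p
  have hline : HasDerivAt (fun y : ℝ => (y, p.2)) ((1 : ℝ), (0 : ℝ)) p.1 :=
    (hasDerivAt_id _).prodMk (hasDerivAt_const _ _)
  exact (HasFDerivAt.comp_hasDerivAt (f := fun y : ℝ => (y, p.2)) p.1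
    (hf.differentiable hl p).hasFDerivAt hline).deriv

theorem hasFDerivAt_of_partial (h₁ : ∀ x t, HasDerivAt (fun y => f y t) (f₁ x t) x)
    (h₂ : ∀ x t, HasDerivAt (f x) (f₂ x t) t) (hc₁ : Continuous fun p : ℝ × ℝ => f₁ p.1 p.2)
    (hc₂ : Continuous fun p : ℝ × ℝ => f₂ p.1 p.2) (p : ℝ × ℝ) :
    HasFDerivAt (fun p : ℝ × ℝ => f p.1 p.2)
      ((ContinuousLinearMap.toSpanSingleton ℝ (f₁ p.1 p.2)).coprod
        (ContinuousLinearMap.toSpanSingleton ℝ (f₂ p.1 p.2))) p := by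
  have hD : Continuous fun c : F => ContinuousLinearMap.toSpanSingleton ℝ c :=
    (ContinuousLinearMap.toSpanSingletonCLE (𝕜 := ℝ) (E := F)).continuous
  exact (hasStrictFDerivAt_uncurry_coprod (𝕜 := ℝ) (f := f) (u := p)
    (f₁ := fun x t => ContinuousLinearMap.toSpanSingleton ℝ (f₁ x t))
    (f₂ := fun x t => ContinuousLinearMap.toSpanSingleton ℝ (f₂ x t))
    (Eventually.of_forall fun v => (h₁ v.1 v.2).hasFDerivAt)
    (Eventually.of_forall fun v => (h₂ v.1 v.2).hasFDerivAt)
    (hD.comp hc₁).continuousAt (hD.comp hc₂).continuousAt).hasFDerivAt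

theorem contDiff_of_partial_bootstrap (hf : Continuous fun p : ℝ × ℝ => f p.1 p.2)
    (h₁ : ∀ x t, HasDerivAt (fun y => f y t) (f₁ x t) x) (h₂ : ∀ x t, HasDerivAt (f x) (f₂ x t) t)
    (hb : ∀ n : ℕ, ContDiff ℝ n (fun p : ℝ × ℝ => f p.1 p.2) →
      ContDiff ℝ n (fun p : ℝ × ℝ => f₁ p.1 p.2) ∧ ContDiff ℝ n fun p : ℝ × ℝ => f₂ p.1 p.2) :
    ContDiff ℝ ∞ fun p : ℝ × ℝ => f p.1 p.2 := by
  have hzero : ContDiff ℝ (0 : ℕ) fun p : ℝ × ℝ => f p.1 p.2 := contDiff_zero.mpr hf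
  rw [contDiff_infty]
  intro n
  induction n with
  | zero => exact hzero
  | succ n ih =>
    refine contDiff_succ_iff_hasFDerivAt.mpr ⟨_, contDiff_clm_apply_iff.mpr fun v => ?_,
      hasFDerivAt_of_partial h₁ h₂ (hb 0 hzero).1.continuous (hb 0 hzero).2.continuous⟩
    simp only [ContinuousLinearMap.coprod_apply, ContinuousLinearMap.toSpanSingleton_apply]
    exact (contDiff_const.smul (hb n ih).1).add (contDiff_const.smul (hb n ih).2)

end PartialDerivatives

section Backlund

variable {q f f' r : ℝ → ℝ → ℝ} {s c : ℝ}

theorem IsSineGordon.hasDerivAt_fst (hq : IsSineGordon q) (x t : ℝ) :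
    HasDerivAt (fun y => q y t) (deriv (fun y => q y t) x) x :=
  (differentiable_fst hq.smooth (by simp) t x).hasDerivAt

theorem IsSineGordon.contDiff_deriv (hq : IsSineGordon q) :
    ContDiff ℝ ∞ fun p : ℝ × ℝ => deriv (fun y => q y p.2) p.1 :=
  contDiff_deriv_fst hq.smooth le_rfl

theorem IsSineGordon.hasDerivAt_deriv (hq : IsSineGordon q) (x t : ℝ) :
    HasDerivAt (fun τ => deriv (fun y => q y τ) x) (Real.sin (q x t)) t := by
  rw [← hq.eqn x t]
  exact (differentiable_snd (f := fun x t => deriv (fun y => q y t) x) hq.contDiff_deriv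
    (by simp) x t).hasDerivAt

theorem lipschitzOnCompacts_add_mul_sin_sub {M : Type*} [TopologicalSpace M] (A B : M → ℝ)
    (c : ℝ) : LipschitzOnCompacts fun m (y : ℝ) => A m + c * Real.sin (y - B m) := by
  refine fun S _ => ⟨‖c‖₊, fun m _ => LipschitzWith.of_dist_le_mul fun y y' => ?_⟩
  rw [dist_add_left, Real.dist_eq, Real.dist_eq, ← mul_sub, abs_mul, coe_nnnorm, Real.norm_eq_abs]
  refine mul_le_mul_of_nonneg_left ((Real.abs_sin_sub_sin_le _ _).trans_eq ?_) (abs_nonneg c)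
  rw [sub_sub_sub_cancel_right]

/-- The right-hand side of the `x`-part `f_x = q_x + 2 s sin f` of the Bäcklund system for the
angle `f`, as a function of `((x, t), f)`. -/
def backlundX (s : ℝ) (q : ℝ → ℝ → ℝ) (p : (ℝ × ℝ) × ℝ) : ℝ :=
  deriv (fun y => q y p.1.2) p.1.1 + 2 * s * Real.sin p.2

/-- The right-hand side of the `t`-part `f_t = sin (f - q) / (2 s)` of the Bäcklund system for the
angle `f`, as a function of `((x, t), f)`. -/
def backlundT (s : ℝ) (q : ℝ → ℝ → ℝ) (p : (ℝ × ℝ) × ℝ) : ℝ :=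
  1 / (2 * s) * Real.sin (p.2 - q p.1.1 p.1.2)

/-- The classical Bäcklund system, written for the angle `f = (r + q) / 2` attached to a
transform `r` of `q`. -/
structure IsBacklundAngle (s : ℝ) (q f : ℝ → ℝ → ℝ) : Prop where
  deriv_x : ∀ x t, HasDerivAt (fun y => f y t) (backlundX s q ((x, t), f x t)) x
  deriv_t : ∀ x t, HasDerivAt (f x) (backlundT s q ((x, t), f x t)) t

theorem lipschitzOnCompacts_backlundX (s : ℝ) (q : ℝ → ℝ → ℝ) :
    LipschitzOnCompacts (backlundX s q).curry := by
  simpa only [Pi.zero_apply, sub_zero] using! lipschitzOnCompacts_add_mul_sin_sub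
    (fun m : ℝ × ℝ => deriv (fun y => q y m.2) m.1) 0 (2 * s)

theorem lipschitzOnCompacts_backlundT (s : ℝ) (q : ℝ → ℝ → ℝ) :
    LipschitzOnCompacts (backlundT s q).curry := by
  simpa only [Pi.zero_apply, zero_add] using! lipschitzOnCompacts_add_mul_sin_sub
    0 (fun m : ℝ × ℝ => q m.1 m.2) (1 / (2 * s))

theorem IsSineGordon.contDiff_backlundX (hq : IsSineGordon q) (s : ℝ) :
    ContDiff ℝ ∞ (backlundX s q) :=
  (hq.contDiff_deriv.comp contDiff_fst).add (contDiff_const.mul contDiff_snd.sin)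

theorem IsSineGordon.contDiff_backlundT (hq : IsSineGordon q) (s : ℝ) :
    ContDiff ℝ ∞ (backlundT s q) :=
  contDiff_const.mul (contDiff_snd.sub (hq.smooth.comp contDiff_fst)).sin

theorem IsSineGordon.lineDeriv_backlundX (hq : IsSineGordon q) (hs : s ≠ 0) (p : (ℝ × ℝ) × ℝ) :
    lineDeriv ℝ (backlundX s q) p ((0, 1), backlundT s q p) =
      Real.sin p.2 * Real.cos (p.2 - q p.1.1 p.1.2) := by
  obtain ⟨⟨x, t⟩, y⟩ := p
  have hqx : HasDerivAt (fun h => deriv (fun y => q y (t + h)) x) (Real.sin (q x t)) 0 := by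
    simpa using! (hq.hasDerivAt_deriv x (t + 0)).comp_const_add t 0
  have hy : HasDerivAt (fun h => y + h * backlundT s q ((x, t), y))
      (backlundT s q ((x, t), y)) 0 := by
    simpa using! ((hasDerivAt_id (0 : ℝ)).mul_const (backlundT s q ((x, t), y))).const_add y
  have hline := hqx.add (hy.sin.const_mul (2 * s))
  have hsin : Real.sin (q x t) = Real.sin (y - (y - q x t)) := by rw [sub_sub_cancel]
  rw [lineDeriv]
  simp only [backlundX, Prod.smul_mk, Prod.mk_add_mk, smul_eq_mul, mul_zero, mul_one, add_zero]
  refine hline.deriv.trans ?_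
  rw [hsin, Real.sin_sub, backlundT, zero_mul, add_zero]
  field_simp
  ring

theorem IsSineGordon.lineDeriv_backlundT (hq : IsSineGordon q) (hs : s ≠ 0) (p : (ℝ × ℝ) × ℝ) :
    lineDeriv ℝ (backlundT s q) p ((1, 0), backlundX s q p) =
      Real.sin p.2 * Real.cos (p.2 - q p.1.1 p.1.2) := by
  obtain ⟨⟨x, t⟩, y⟩ := p
  have hq' : HasDerivAt (fun h => q (x + h) t) (deriv (fun y => q y t) x) 0 := by
    simpa using! (hq.hasDerivAt_fst (x + 0) t).comp_const_add x 0
  have hy : HasDerivAt (fun h => y + h * backlundX s q ((x, t), y))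
      (backlundX s q ((x, t), y)) 0 := by
    simpa using! ((hasDerivAt_id (0 : ℝ)).mul_const (backlundX s q ((x, t), y))).const_add y
  have hline := (hy.sub hq').sin.const_mul (1 / (2 * s))
  rw [lineDeriv]
  simp only [backlundT, Prod.smul_mk, Prod.mk_add_mk, smul_eq_mul, mul_zero, mul_one, add_zero]
  refine hline.deriv.trans ?_
  simp only [Pi.sub_apply, backlundX, zero_mul, add_zero]
  field_simp
  ring

theorem IsSineGordon.exists_isBacklundAngle (hq : IsSineGordon q) (hs : s ≠ 0) (f₀ : ℝ) :
    ∃ f, IsBacklundAngle s q f ∧ f 0 0 = f₀ := by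
  obtain ⟨f, hf₀, hfx, hft⟩ := exists_hasDerivAt_of_lineDeriv_comm
    ((hq.contDiff_backlundX s).of_le (by simp)) ((hq.contDiff_backlundT s).of_le (by simp))
    (lipschitzOnCompacts_backlundX s q) (lipschitzOnCompacts_backlundT s q)
    (fun p => (hq.lineDeriv_backlundX hs p).trans (hq.lineDeriv_backlundT hs p).symm) f₀
  exact ⟨f, ⟨hfx, hft⟩, hf₀⟩

theorem IsBacklundAngle.unique (hf : IsBacklundAngle s q f) (hf' : IsBacklundAngle s q f')
    (h0 : f 0 0 = f' 0 0) : f = f' := by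
  have ht : f 0 = f' 0 :=
    ((lipschitzOnCompacts_backlundT s q).comp (φ := fun t => (0, t))
      (by fun_prop)).eq_of_isIntegralCurve (hf.deriv_t 0) (hf'.deriv_t 0) h0
  funext x t
  exact congrFun (((lipschitzOnCompacts_backlundX s q).comp (φ := fun x => (x, t))
    (by fun_prop)).eq_of_isIntegralCurve (fun x => hf.deriv_x x t) (fun x => hf'.deriv_x x t)
    (congrFun ht t)) x

theorem IsBacklundAngle.continuous (hf : IsBacklundAngle s q f) :
    Continuous fun p : ℝ × ℝ => f p.1 p.2 := by
  refine continuous_prod_of_continuous_lipschitzWith' _ ‖1 / (2 * s)‖₊ (fun x => ?_)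
    fun t => continuous_iff_continuousAt.mpr fun x => (hf.deriv_x x t).continuousAt
  refine lipschitzWith_of_nnnorm_deriv_le (fun t => (hf.deriv_t x t).differentiableAt) fun t => ?_
  rw [(hf.deriv_t x t).deriv, backlundT, nnnorm_mul]
  exact mul_le_of_le_one_right' (Real.abs_sin_le_one _)

theorem IsBacklundAngle.contDiff (hf : IsBacklundAngle s q f) (hq : IsSineGordon q) :
    ContDiff ℝ ∞ fun p : ℝ × ℝ => f p.1 p.2 := by
  refine contDiff_of_partial_bootstrap hf.continuous hf.deriv_x hf.deriv_t fun n hn => ?_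
  have hn' : (n : WithTop ℕ∞) ≤ ∞ := by exact_mod_cast le_top
  have hgraph : ContDiff ℝ n fun p : ℝ × ℝ => (p, f p.1 p.2) := contDiff_id.prodMk hn
  exact ⟨((hq.contDiff_backlundX s).of_le hn').comp hgraph,
    ((hq.contDiff_backlundT s).of_le hn').comp hgraph⟩

theorem isClassicalBacklund_iff (hq : IsSineGordon q) (hs : s ≠ 0) :
    IsClassicalBacklund s c q (fun x t => 2 * f x t - q x t) ↔
      IsBacklundAngle s q f ∧ 2 * f 0 0 - q 0 0 = c := by
  have hsum (x t : ℝ) : (2 * f x t - q x t + q x t) / 2 = f x t := by ring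
  have hdiff (x t : ℝ) : (2 * f x t - q x t - q x t) / 2 = f x t - q x t := by ring
  constructor
  · refine fun h => ⟨⟨fun x t => ?_, fun x t => ?_⟩, h.base⟩
    · have hx := ((h.deriv_x x t).fun_add ((hq.hasDerivAt_fst x t).const_mul 2)).const_mul (1 / 2)
      rw [hsum] at hx
      convert! hx using 1
      · funext y; ring
      · rw [backlundX]; ring
    · have ht := (h.deriv_t x t).const_mul (1 / 2)
      rw [hdiff] at ht
      convert! ht using 1
      · funext τ; ring
      · rw [backlundT]; field_simp
  · rintro ⟨h, h0⟩
    refine ⟨fun x t => ?_, fun x t => ?_, h0⟩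
    · rw [hsum]
      convert! ((h.deriv_x x t).const_mul 2).fun_sub ((hq.hasDerivAt_fst x t).const_mul 2) using 1
      · funext y; ring
      · rw [backlundX]; ring
    · rw [hdiff]
      convert! (h.deriv_t x t).const_mul 2 using 1
      · funext τ; ring
      · rw [backlundT]; field_simp

theorem IsClassicalBacklund.eq_of_isBacklundAngle (hr : IsClassicalBacklund s c q r)
    (hf : IsBacklundAngle s q f) (hq : IsSineGordon q) (hs : s ≠ 0)
    (h0 : f 0 0 = (q 0 0 + c) / 2) : r = fun x t => 2 * f x t - q x t := by
  have hr_eq : r = fun x t => 2 * ((r x t + q x t) / 2) - q x t := by funext x t; ring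
  have hangle : IsBacklundAngle s q fun x t => (r x t + q x t) / 2 :=
    ((isClassicalBacklund_iff hq hs).mp (hr_eq ▸ hr)).1
  have hrf := hangle.unique hf (by rw [h0, hr.base, add_comm])
  simpa only [← hrf] using hr_eq

theorem IsBacklundAngle.deriv_transform (hf : IsBacklundAngle s q f) (hq : IsSineGordon q)
    (x t : ℝ) : deriv (fun y => 2 * f y t - q y t) x =
      deriv (fun y => q y t) x + 4 * s * Real.sin (f x t) := by
  rw [(((hf.deriv_x x t).const_mul 2).fun_sub (hq.hasDerivAt_fst x t)).deriv, backlundX]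
  ring

theorem IsBacklundAngle.isSineGordon (hf : IsBacklundAngle s q f) (hq : IsSineGordon q)
    (hs : s ≠ 0) : IsSineGordon fun x t => 2 * f x t - q x t := by
  refine ⟨(contDiff_const.mul (hf.contDiff hq)).sub hq.smooth, fun x t => ?_⟩
  have hsub : q x t = f x t - (f x t - q x t) := by ring
  have hadd : 2 * f x t - q x t = f x t + (f x t - q x t) := by ring
  simp only [hf.deriv_transform hq]
  refine ((hq.hasDerivAt_deriv x t).add ((hf.deriv_t x t).sin.const_mul (4 * s))).deriv.trans ?_
  rw [hadd, Real.sin_add, backlundT]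
  nth_rw 1 [hsub]
  rw [Real.sin_sub]
  field_simp
  ring

end Backlund

/-! ### The Lax pair of a sine-Gordon solution -/

section Reflection

open scoped Matrix.Norms.L2Operator

theorem isHermitianProjectionOnto_vecMulVec {n : Type*} [Fintype n] [DecidableEq n] {v : n → ℂ}
    (hv : star v ⬝ᵥ v = 1) : IsHermitianProjectionOnto (vecMulVec v (star v)) (ℂ ∙ v) := by
  have happly (w : n → ℂ) : toLin' (vecMulVec v (star v)) w = (star v ⬝ᵥ w) • v := by
    simp [vecMulVec_mulVec]
  refine ⟨by simp [conjTranspose_vecMulVec], by simp [vecMulVec_mul_vecMulVec, hv],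
    le_antisymm ?_ ?_⟩
  · rintro _ ⟨w, rfl⟩
    exact happly w ▸ Submodule.smul_mem _ _ (Submodule.mem_span_singleton_self v)
  · exact (Submodule.span_singleton_le_iff_mem _ _).mpr ⟨v, by rw [happly, hv, one_smul]⟩

theorem isHermitianProjectionOnto_angleProj (θ : ℝ) :
    IsHermitianProjectionOnto (angleProj θ) (angleLine θ) := by
  have hnorm : ((Real.sin (θ / 2) : ℝ) : ℂ) ^ 2 + ((Real.cos (θ / 2) : ℝ) : ℂ) ^ 2 = 1 := by
    exact_mod_cast Real.sin_sq_add_cos_sq (θ / 2)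
  convert! isHermitianProjectionOnto_vecMulVec
    (v := ![((Real.cos (θ / 2) : ℝ) : ℂ), ((Real.sin (θ / 2) : ℝ) : ℂ)]) ?_ using 1
  · ext i j
    fin_cases i <;> fin_cases j <;>
      simp [angleProj, vecMulVec_apply, -Complex.ofReal_cos, -Complex.ofReal_sin] <;> ring
  · simp only [dotProduct, Fin.sum_univ_two, Pi.star_apply, cons_val_zero, cons_val_one,
      RCLike.star_def, Complex.conj_ofReal]
    linear_combination hnorm

theorem isStarProjection_angleProj (θ : ℝ) : IsStarProjection (angleProj θ) :=
  (isHermitianProjectionOnto_angleProj θ).isStarProjection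

theorem isSymm_angleProj (θ : ℝ) : (angleProj θ).IsSymm := by
  ext i j
  fin_cases i <;> fin_cases j <;> simp [angleProj]

/-- The infinitesimal rotation `[[0, 1], [-1, 0]]`. -/
def sgJ : Matrix (Fin 2) (Fin 2) ℂ := !![0, 1; -1, 0]

/-- The orthogonal reflection of the plane in the line of angle `θ / 2`. -/
def reflMatrix (θ : ℝ) : Matrix (Fin 2) (Fin 2) ℂ :=
  !![((Real.cos θ : ℝ) : ℂ), ((Real.sin θ : ℝ) : ℂ);
     ((Real.sin θ : ℝ) : ℂ), -((Real.cos θ : ℝ) : ℂ)]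

theorem angleProj_eq (θ : ℝ) : angleProj θ = (1 / 2 : ℂ) • (1 + reflMatrix θ) := by
  have hcos : Real.cos θ = 2 * Real.cos (θ / 2) ^ 2 - 1 := by
    rw [← Real.cos_two_mul, mul_div_cancel₀ _ two_ne_zero]
  have hsin : Real.sin θ = 2 * Real.sin (θ / 2) * Real.cos (θ / 2) := by
    rw [← Real.sin_two_mul, mul_div_cancel₀ _ two_ne_zero]
  ext i j
  fin_cases i <;> fin_cases j <;>
    simp [angleProj, reflMatrix, hcos, hsin, Real.sin_sq, -Complex.ofReal_cos,
      -Complex.ofReal_sin] <;> ring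

theorem conjTranspose_reflMatrix (θ : ℝ) : (reflMatrix θ)ᴴ = reflMatrix θ := by
  ext i j
  fin_cases i <;> fin_cases j <;>
    simp [reflMatrix, -Complex.ofReal_cos, -Complex.ofReal_sin]

theorem reflMatrix_conj (θ φ : ℝ) :
    reflMatrix θ * reflMatrix φ * reflMatrix θ = reflMatrix (2 * θ - φ) := by
  have hcos : Real.cos (2 * θ - φ) = Real.cos θ * Real.cos φ * Real.cos θ +
      2 * Real.sin θ * Real.sin φ * Real.cos θ - Real.sin θ * Real.cos φ * Real.sin θ := by
    rw [Real.cos_sub, Real.cos_two_mul', Real.sin_two_mul]; ring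
  have hsin : Real.sin (2 * θ - φ) = Real.sin θ * Real.sin φ * Real.sin θ +
      2 * Real.cos θ * Real.cos φ * Real.sin θ - Real.cos θ * Real.sin φ * Real.cos θ := by
    rw [Real.sin_sub, Real.cos_two_mul', Real.sin_two_mul]; ring
  ext i j
  fin_cases i <;> fin_cases j <;>
    simp [reflMatrix, hcos, hsin, -Complex.ofReal_cos, -Complex.ofReal_sin] <;> ring

theorem reflMatrix_add_sub_reflMatrix_sub (θ φ : ℝ) :
    reflMatrix (θ + φ) - reflMatrix (θ - φ) =
      ((2 * Real.sin φ : ℝ) : ℂ) • (reflMatrix θ * sgJ) := by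
  ext i j
  fin_cases i <;> fin_cases j <;>
    simp [reflMatrix, sgJ, Real.cos_add, Real.cos_sub, Real.sin_add, Real.sin_sub,
      -Complex.ofReal_cos, -Complex.ofReal_sin] <;> ring

theorem sgJ_mul_reflMatrix (θ : ℝ) : sgJ * reflMatrix θ = -(reflMatrix θ * sgJ) := by
  ext i j
  fin_cases i <;> fin_cases j <;> simp [reflMatrix, sgJ]

theorem reflMatrix_mul_sgJ_ne_zero (θ : ℝ) : reflMatrix θ * sgJ ≠ 0 := fun h => by
  have hdet : (reflMatrix θ * sgJ).det = -((Real.sin θ : ℂ) ^ 2 + (Real.cos θ : ℂ) ^ 2) := by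
    simp only [reflMatrix, sgJ, det_mul, det_fin_two_of]
    ring
  simp [h] at hdet

theorem sgA_mul_reflMatrix_sub (θ : ℝ) :
    sgA * reflMatrix θ - reflMatrix θ * sgA = (2 * Complex.I * (Real.sin θ : ℝ)) • sgJ := by
  ext i j
  fin_cases i <;> fin_cases j <;>
    simp [reflMatrix, sgA, sgJ, -Complex.ofReal_cos, -Complex.ofReal_sin] <;> ring

theorem hasDerivAt_reflMatrix {θ : ℝ → ℝ} {θ' x : ℝ} (hθ : HasDerivAt θ θ' x) :
    HasDerivAt (fun y => reflMatrix (θ y)) ((θ' : ℂ) • (reflMatrix (θ x) * sgJ)) x := by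
  refine hasMatDerivAt_iff.mp fun i j => ?_
  fin_cases i <;> fin_cases j
  · exact hθ.cos.ofReal_comp.congr_deriv (by simp [reflMatrix, sgJ, mul_comm])
  · exact hθ.sin.ofReal_comp.congr_deriv (by simp [reflMatrix, sgJ, mul_comm])
  · exact hθ.sin.ofReal_comp.congr_deriv (by simp [reflMatrix, sgJ, mul_comm])
  · exact hθ.cos.ofReal_comp.neg.congr_deriv (by simp [reflMatrix, sgJ, mul_comm])

theorem hasDerivAt_angleProj {θ : ℝ → ℝ} {θ' x : ℝ} (hθ : HasDerivAt θ θ' x) :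
    HasDerivAt (fun y => angleProj (θ y)) (((θ' / 2 : ℝ) : ℂ) • (reflMatrix (θ x) * sgJ)) x := by
  simp only [angleProj_eq]
  refine (((hasDerivAt_reflMatrix hθ).const_add 1).const_smul (1 / 2 : ℂ)).congr_deriv ?_
  rw [smul_smul]
  push_cast
  ring_nf

theorem hasMatDerivAt_angleProj_iff {θ : ℝ → ℝ} {c x : ℝ} (hθ : DifferentiableAt ℝ θ x) :
    HasMatDerivAt (fun y => angleProj (θ y)) (((c / 2 : ℝ) : ℂ) • (reflMatrix (θ x) * sgJ)) x ↔
      HasDerivAt θ c x := by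
  refine hasMatDerivAt_iff.trans ⟨fun h => ?_, hasDerivAt_angleProj⟩
  have heq := (hasDerivAt_angleProj hθ.hasDerivAt).unique h
  have hc : deriv θ x / 2 = c / 2 :=
    Complex.ofReal_injective (smul_left_injective ℂ (reflMatrix_mul_sgJ_ne_zero (θ x)) heq)
  exact hθ.hasDerivAt.congr_deriv ((div_left_inj' two_ne_zero).mp hc)

end Reflection

section SineGordonLaxPair

open scoped Matrix.Norms.L2Operator

variable {q : ℝ → ℝ → ℝ}

/-- The field `g⁻¹ b g` of the frame `g = exp ((θ / 2) J)`. -/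
def sgQ (θ : ℝ) : Matrix (Fin 2) (Fin 2) ℂ := (-(Complex.I / 4)) • reflMatrix θ

theorem sgPotential_eq (q : ℝ → ℝ → ℝ) (x t : ℝ) :
    sgPotential q x t = ((deriv (fun y => q y t) x / 2 : ℝ) : ℂ) • sgJ := by
  ext i j
  fin_cases i <;> fin_cases j <;> simp [sgPotential, sgJ]

theorem conjTranspose_sgPotential (q : ℝ → ℝ → ℝ) (x t : ℝ) :
    (sgPotential q x t)ᴴ = -sgPotential q x t := by
  ext i j
  fin_cases i <;> fin_cases j <;> simp [sgPotential]

theorem transpose_sgPotential (q : ℝ → ℝ → ℝ) (x t : ℝ) :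
    (sgPotential q x t)ᵀ = -sgPotential q x t := by
  ext i j
  fin_cases i <;> fin_cases j <;> simp [sgPotential]

theorem sgPotential_mem_twistedPerp (q : ℝ → ℝ → ℝ) (x t : ℝ) :
    sgPotential q x t ∈ twistedPerp sgA := by
  refine ⟨conjTranspose_sgPotential q x t, ?_, ?_, ?_⟩
  · simp [sgPotential, trace_fin_two]
  · rw [transpose_sgPotential, neg_neg]
  · simp [sgPotential, sgA, trace_fin_two]

theorem conjTranspose_sgA : sgAᴴ = -sgA := by
  ext i j
  fin_cases i <;> fin_cases j <;> simp [sgA]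

theorem conjTranspose_sgQ (θ : ℝ) : (sgQ θ)ᴴ = -sgQ θ := by
  rw [sgQ, conjTranspose_smul, conjTranspose_reflMatrix, ← neg_smul]
  simp [neg_div]

theorem sgA_mul_sgQ_sub (θ : ℝ) :
    sgA * sgQ θ - sgQ θ * sgA = ((Real.sin θ / 2 : ℝ) : ℂ) • sgJ := by
  rw [sgQ, mul_smul_comm, smul_mul_assoc, ← smul_sub, sgA_mul_reflMatrix_sub, smul_smul]
  congr 1
  push_cast
  linear_combination (-(Complex.sin θ) / 2) * Complex.I_mul_I

theorem IsSineGordon.contDiff_sgPotential (hq : IsSineGordon q) (i j : Fin 2) :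
    ContDiff ℝ ∞ fun p : ℝ × ℝ => sgPotential q p.1 p.2 i j := by
  simp only [sgPotential_eq, Matrix.smul_apply, smul_eq_mul]
  exact (Complex.ofRealCLM.contDiff.comp (hq.contDiff_deriv.div_const 2)).mul contDiff_const

theorem IsSineGordon.hasDerivAt_sgPotential (hq : IsSineGordon q) (x t : ℝ) :
    HasDerivAt (sgPotential q x) (sgA * sgQ (q x t) - sgQ (q x t) * sgA) t := by
  rw [sgA_mul_sgQ_sub, funext (sgPotential_eq q x)]
  exact ((hq.hasDerivAt_deriv x t).div_const 2).ofReal_comp.smul_const sgJ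

theorem IsSineGordon.isLaxPair (hq : IsSineGordon q) :
    IsLaxPair sgA (sgPotential q) fun x t => sgQ (q x t) where
  contDiff_x i j := (hq.contDiff_sgPotential i j).of_le (by simp)
  contDiff_t i j := by
    have hcos := Complex.ofRealCLM.contDiff.comp (hq.smooth.cos.of_le (m := 1) (by simp))
    have hsin := Complex.ofRealCLM.contDiff.comp (hq.smooth.sin.of_le (m := 1) (by simp))
    fin_cases i <;> fin_cases j
    exacts [contDiff_const.mul hcos, contDiff_const.mul hsin, contDiff_const.mul hsin,
      contDiff_const.mul hcos.neg]
  deriv_t := hq.hasDerivAt_sgPotential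
  deriv_x x t := by
    refine ((hasDerivAt_reflMatrix (hq.hasDerivAt_fst x t)).const_smul
      (-(Complex.I / 4))).congr_deriv ?_
    rw [sgQ, sgPotential_eq]
    simp only [smul_mul_assoc, mul_smul_comm, sgJ_mul_reflMatrix, smul_neg, sub_neg_eq_add]
    push_cast
    module
  skew_a := conjTranspose_sgA
  skew_x := conjTranspose_sgPotential q
  skew_t x t := conjTranspose_sgQ (q x t)

end SineGordonLaxPair

/-! ### Frames of a sine-Gordon solution -/

section Frames

open scoped Matrix.Norms.L2Operator

variable {q : ℝ → ℝ → ℝ} {g : ℝ → ℝ → Matrix (Fin 2) (Fin 2) ℂ}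

theorem transpose_sgFrame_mul (q : ℝ → ℝ → ℝ) (x t : ℝ) :
    (sgFrame q x t)ᵀ * sgFrame q x t = 1 := by
  ext i j
  fin_cases i <;> fin_cases j <;>
    simp [sgFrame, mul_apply, ← sq, Complex.cos_sq_add_sin_sq, Complex.sin_sq_add_cos_sq, mul_comm]

theorem sgFrame_inv (q : ℝ → ℝ → ℝ) (x t : ℝ) : (sgFrame q x t)⁻¹ = (sgFrame q x t)ᵀ :=
  inv_eq_left_inv (transpose_sgFrame_mul q x t)

theorem isUnit_det_sgFrame (q : ℝ → ℝ → ℝ) (x t : ℝ) : IsUnit (sgFrame q x t).det :=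
  isUnit_det_of_left_inverse (transpose_sgFrame_mul q x t)

theorem frameConj_sgFrame (q : ℝ → ℝ → ℝ) (x t : ℝ) :
    frameConj sgB (sgFrame q) x t = sgQ (q x t) := by
  have hcos : Real.cos (q x t) = Real.cos (q x t / 2) ^ 2 - Real.sin (q x t / 2) ^ 2 := by
    rw [← Real.cos_two_mul', mul_div_cancel₀ _ two_ne_zero]
  have hsin : Real.sin (q x t) = 2 * Real.sin (q x t / 2) * Real.cos (q x t / 2) := by
    rw [← Real.sin_two_mul, mul_div_cancel₀ _ two_ne_zero]
  rw [frameConj, sgFrame_inv]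
  ext i j
  fin_cases i <;> fin_cases j <;>
    simp [sgFrame, sgB, sgA, sgQ, reflMatrix, mul_apply, Fin.sum_univ_two, hcos, hsin,
      -Complex.ofReal_cos, -Complex.ofReal_sin] <;> ring

theorem frameConj_smul_sgFrame (q : ℝ → ℝ → ℝ) {c : ℝ → ℂ} (x t : ℝ) (hc : c t * c t = 1) :
    frameConj sgB (fun x t => c t • sgFrame q x t) x t = sgQ (q x t) := by
  have hinv : (c t • sgFrame q x t)⁻¹ = c t • (sgFrame q x t)⁻¹ := by
    refine inv_eq_left_inv ?_
    rw [smul_mul_smul_comm, hc, one_smul, sgFrame_inv, transpose_sgFrame_mul]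
  rw [frameConj, hinv, smul_mul_assoc, smul_mul_smul_comm, hc, one_smul, ← frameConj_sgFrame,
    frameConj]

theorem IsSineGordon.hasDerivAt_sgFrame (hq : IsSineGordon q) (x t : ℝ) :
    HasDerivAt (fun y => sgFrame q y t) (sgFrame q x t * sgPotential q x t) x := by
  have hhalf := (hq.hasDerivAt_fst x t).div_const 2
  refine hasMatDerivAt_iff.mp fun i j => ?_
  fin_cases i <;> fin_cases j
  · exact hhalf.cos.ofReal_comp.congr_deriv (by simp [sgFrame, sgPotential])
  · exact hhalf.sin.ofReal_comp.congr_deriv (by simp [sgFrame, sgPotential])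
  · exact hhalf.sin.neg.ofReal_comp.congr_deriv (by simp [sgFrame, sgPotential])
  · exact hhalf.cos.ofReal_comp.congr_deriv (by simp [sgFrame, sgPotential])

theorem IsSineGordon.isMinusOneFlow_smul_sgFrame (hq : IsSineGordon q) {c : ℝ → ℂ}
    (hc : ∀ t, c t * c t = 1) :
    IsMinusOneFlow sgA sgB (sgPotential q) (fun x t => c t • sgFrame q x t) := by
  refine ⟨hq.contDiff_sgPotential, fun x t => ?_, fun x t => hasMatDerivAt_iff.mpr ?_,
    fun x t => hasMatDerivAt_iff.mpr ?_⟩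
  · rw [det_smul]
    exact ((IsUnit.of_mul_eq_one _ (hc t)).pow _).mul (isUnit_det_sgFrame q x t)
  · rw [smul_mul_assoc]
    exact (hq.hasDerivAt_sgFrame x t).const_smul (c t)
  · have hconj := frameConj_smul_sgFrame q x t (hc t)
    rw [frameConj] at hconj
    rw [hconj]
    exact hq.hasDerivAt_sgPotential x t

theorem IsSineGordon.isSineGordonFrame_sgFrame (hq : IsSineGordon q) :
    IsSineGordonFrame q (sgFrame q) :=
  ⟨by simpa only [one_smul] using
      hq.isMinusOneFlow_smul_sgFrame (c := fun _ => 1) fun _ => one_mul 1,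
    Or.inl rfl⟩

theorem tendsto_sgFrame {t : ℝ} {k : ℤ}
    (h : Tendsto (fun x => q x t) atBot (𝓝 (2 * Real.pi * k))) :
    Tendsto (fun x => sgFrame q x t) atBot (𝓝 ((-1 : ℂ) ^ k • 1)) := by
  have hhalf : Tendsto (fun x => q x t / 2) atBot (𝓝 (k * Real.pi)) := by
    convert h.div_const 2 using 2
    ring
  have hcos : Tendsto (fun x => ((Real.cos (q x t / 2) : ℝ) : ℂ)) atBot (𝓝 ((-1 : ℂ) ^ k)) := by
    simpa [Real.cos_int_mul_pi, -Complex.ofReal_cos, Function.comp_def] using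
      (Complex.continuous_ofReal.tendsto _).comp ((Real.continuous_cos.tendsto _).comp hhalf)
  have hsin : Tendsto (fun x => ((Real.sin (q x t / 2) : ℝ) : ℂ)) atBot (𝓝 0) := by
    simpa [Real.sin_int_mul_pi, -Complex.ofReal_sin, Function.comp_def] using
      (Complex.continuous_ofReal.tendsto _).comp ((Real.continuous_sin.tendsto _).comp hhalf)
  refine tendsto_pi_nhds.mpr fun i => tendsto_pi_nhds.mpr fun j => ?_
  fin_cases i <;> fin_cases j
  · simpa [sgFrame] using hcos
  · simpa [sgFrame] using hsin
  · simpa [sgFrame] using hsin.neg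
  · simpa [sgFrame] using hcos

theorem neg_one_zpow_mul_self (k : ℤ) : (-1 : ℂ) ^ k * (-1 : ℂ) ^ k = 1 := by
  rw [← mul_zpow, neg_mul_neg, one_mul, _root_.one_zpow]

theorem IsSineGordon.exists_isNormalizedFrame (hq : IsSineGordon q) (hv : VanishesAtBot q) :
    ∃ g, IsSineGordonFrame q g ∧ IsNormalizedFrame g := by
  choose k hk using hv
  have hn : IsNormalizedFrame (fun x t => ((-1 : ℂ) ^ k t) • sgFrame q x t) := fun t => by
    simpa only [smul_smul, neg_one_zpow_mul_self, one_smul] using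
      (tendsto_sgFrame (hk t)).const_smul ((-1 : ℂ) ^ k t)
  exact ⟨_, ⟨hq.isMinusOneFlow_smul_sgFrame fun t => neg_one_zpow_mul_self (k t),
    Or.inr ⟨fun t => ⟨k t, hk t⟩, hn⟩⟩, hn⟩

/- For fixed `t`, the matrix `g (sgFrame q)ᵀ` is constant in `x`, and its limit at `-∞` is `±1`. -/
theorem IsMinusOneFlow.eq_smul_sgFrame (hg : IsMinusOneFlow sgA sgB (sgPotential q) g)
    (hn : IsNormalizedFrame g) (hq : IsSineGordon q) {t : ℝ} {k : ℤ}
    (hk : Tendsto (fun x => q x t) atBot (𝓝 (2 * Real.pi * k))) (x : ℝ) :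
    g x t = (-1 : ℂ) ^ k • sgFrame q x t := by
  have hderiv (ξ : ℝ) : HasDerivAt (fun y => g y t * (sgFrame q y t)ᵀ) 0 ξ := by
    have hT : HasDerivAt (fun y => (sgFrame q y t)ᵀ) (sgFrame q ξ t * sgPotential q ξ t)ᵀ ξ :=
      hasMatDerivAt_iff.mp fun i j => hasMatDerivAt_iff.mpr (hq.hasDerivAt_sgFrame ξ t) j i
    refine ((hasMatDerivAt_iff.mp (hg.frame_x ξ t)).mul hT).congr_deriv ?_
    rw [transpose_mul, transpose_sgPotential]
    noncomm_ring
  have hconst (ξ : ℝ) : g ξ t * (sgFrame q ξ t)ᵀ = g x t * (sgFrame q x t)ᵀ :=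
    is_const_of_deriv_eq_zero (fun y => (hderiv y).differentiableAt) (fun y => (hderiv y).deriv) ξ x
  have hlim : Tendsto (fun ξ => g ξ t * (sgFrame q ξ t)ᵀ) atBot
      (𝓝 (1 * ((-1 : ℂ) ^ k • (1 : Matrix (Fin 2) (Fin 2) ℂ))ᵀ)) :=
    (hn t).mul ((continuous_id.matrix_transpose.tendsto _).comp (tendsto_sgFrame hk))
  simp only [hconst] at hlim
  have hx := congrArg (· * sgFrame q x t) (tendsto_nhds_unique tendsto_const_nhds hlim)
  simpa [mul_assoc, transpose_sgFrame_mul] using hx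

theorem IsSineGordonFrame.frameConj_eq (hg : IsSineGordonFrame q g) (hq : IsSineGordon q) :
    frameConj sgB g = fun x t => sgQ (q x t) := by
  funext x t
  obtain ⟨hflow, rfl | ⟨hv, hn⟩⟩ := hg
  · exact frameConj_sgFrame q x t
  · obtain ⟨k, hk⟩ := hv t
    rw [frameConj, hflow.eq_smul_sgFrame hn hq hk x]
    exact frameConj_smul_sgFrame q (c := fun _ => (-1) ^ k) x t (neg_one_zpow_mul_self k)

theorem IsSineGordonFrame.isLaxPair (hg : IsSineGordonFrame q g) (hq : IsSineGordon q) :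
    IsLaxPair sgA (sgPotential q) (frameConj sgB g) :=
  hg.frameConj_eq hq ▸ hq.isLaxPair

end Frames

/-! ### The projection of a Bäcklund transform -/

section BacklundProjection

variable {q f : ℝ → ℝ → ℝ} {g : ℝ → ℝ → Matrix (Fin 2) (Fin 2) ℂ} {s : ℝ}

theorem star_I_mul_ofReal (s : ℝ) : star (Complex.I * s) = -(Complex.I * s) := by
  simp

theorem simpleElement_angleProj_zero {z : ℂ} (hz : star z = -z) (hz0 : z ≠ 0) (θ : ℝ) :
    simpleElement z (angleProj θ) 0 = reflMatrix θ := by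
  have hdiv : (0 - z) / (0 - star z) = -1 := by
    rw [hz, sub_neg_eq_add, zero_sub, zero_add, neg_div, div_self hz0]
  rw [simpleElement, hdiv, angleProj_eq]
  module

theorem dressedField_angleProj (hs : s ≠ 0) (q f : ℝ → ℝ → ℝ) :
    dressedField (Complex.I * s) (fun x t => angleProj (f x t)) (fun x t => sgQ (q x t)) =
      fun x t => sgQ (2 * f x t - q x t) := by
  have hz0 : Complex.I * (s : ℂ) ≠ 0 := by simpa using hs
  have hz := star_I_mul_ofReal s
  funext x t
  rw [dressedField, simpleElement_angleProj_zero hz hz0,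
    simpleElement_angleProj_zero (by rw [star_star, hz, neg_neg]) (star_ne_zero.mpr hz0), sgQ, sgQ,
    mul_smul_comm, smul_mul_assoc, reflMatrix_conj]

theorem angleProj_mul_sgA_sub (θ : ℝ) :
    angleProj θ * sgA - sgA * angleProj θ = (-Complex.I * (Real.sin θ : ℝ)) • sgJ := by
  have hcomm := sgA_mul_reflMatrix_sub θ
  rw [angleProj_eq, mul_smul_comm, smul_mul_assoc, add_mul, mul_add, one_mul, mul_one, ← smul_sub,
    add_sub_add_left_eq_sub, ← neg_sub, hcomm]
  module

theorem IsBacklundAngle.dressedPotential_eq (hf : IsBacklundAngle s q f) (hq : IsSineGordon q) :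
    dressedPotential sgA (Complex.I * s) (fun x t => angleProj (f x t)) (sgPotential q) =
      sgPotential fun x t => 2 * f x t - q x t := by
  funext x t
  rw [dressedPotential, angleProj_mul_sgA_sub, star_I_mul_ofReal, sgPotential_eq, sgPotential_eq,
    hf.deriv_transform hq, smul_smul, ← add_smul]
  congr 1
  push_cast
  linear_combination (-2 * (s : ℂ) * Complex.sin (f x t)) * Complex.I_mul_I

theorem IsBacklundAngle.isLaxPair_dressed (hf : IsBacklundAngle s q f) (hq : IsSineGordon q)
    (hs : s ≠ 0) (hg : IsSineGordonFrame q g) :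
    IsLaxPair sgA
      (dressedPotential sgA (Complex.I * s) (fun x t => angleProj (f x t)) (sgPotential q))
      (dressedField (Complex.I * s) (fun x t => angleProj (f x t)) (frameConj sgB g)) := by
  rw [hf.dressedPotential_eq hq, hg.frameConj_eq hq, dressedField_angleProj hs]
  exact (hf.isSineGordon hq hs).isLaxPair

theorem projectionSystem_x_angleProj (q : ℝ → ℝ → ℝ) (s θ x t : ℝ) :
    (star (Complex.I * s) - Complex.I * s) •
        ((angleProj θ * sgA - sgA * angleProj θ) * angleProj θ) -
      (((Complex.I * s) • sgA + sgPotential q x t) * angleProj θ -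
        angleProj θ * ((Complex.I * s) • sgA + sgPotential q x t)) =
      ((backlundX s q ((x, t), θ) / 2 : ℝ) : ℂ) • (reflMatrix θ * sgJ) := by
  have hpot : sgPotential q x t * angleProj θ - angleProj θ * sgPotential q x t =
      (-(deriv (fun y => q y t) x / 2 : ℝ) : ℂ) • (reflMatrix θ * sgJ) := by
    simp only [sgPotential_eq, angleProj_eq, mul_smul_comm, smul_mul_assoc, mul_add, add_mul,
      mul_one, one_mul, sgJ_mul_reflMatrix]
    module
  have hJP : sgJ * angleProj θ = (1 / 2 : ℂ) • (sgJ - reflMatrix θ * sgJ) := by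
    rw [angleProj_eq, mul_smul_comm, mul_add, mul_one, sgJ_mul_reflMatrix, ← sub_eq_add_neg]
  have hsplit : ((Complex.I * s) • sgA + sgPotential q x t) * angleProj θ -
      angleProj θ * ((Complex.I * s) • sgA + sgPotential q x t) =
      (sgPotential q x t * angleProj θ - angleProj θ * sgPotential q x t) -
        (Complex.I * s) • (angleProj θ * sgA - sgA * angleProj θ) := by
    simp only [add_mul, mul_add, smul_mul_assoc, mul_smul_comm]
    module
  rw [hsplit, hpot, angleProj_mul_sgA_sub, smul_mul_assoc, hJP, star_I_mul_ofReal, backlundX]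
  push_cast
  match_scalars
  · ring
  · linear_combination (-(s : ℂ) * Complex.sin θ) * Complex.I_mul_I

theorem projectionSystem_t_angleProj (q : ℝ → ℝ → ℝ) (hs : s ≠ 0) (θ x t : ℝ) :
    ((‖Complex.I * (s : ℂ)‖ ^ 2 : ℝ) : ℂ)⁻¹ •
        ((Complex.I * s - star (Complex.I * s)) • (angleProj θ * sgQ (q x t) * angleProj θ) -
          (Complex.I * s) • (sgQ (q x t) * angleProj θ) +
          star (Complex.I * s) • (angleProj θ * sgQ (q x t))) =
      ((backlundT s q ((x, t), θ) / 2 : ℝ) : ℂ) • (reflMatrix θ * sgJ) := by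
  have hs' : (s : ℂ) ≠ 0 := Complex.ofReal_ne_zero.mpr hs
  have hnorm : ((‖Complex.I * (s : ℂ)‖ ^ 2 : ℝ) : ℂ) = (s : ℂ) ^ 2 := by
    rw [norm_mul, Complex.norm_I, one_mul, Complex.norm_real, Real.norm_eq_abs, sq_abs]
    push_cast
    rfl
  have hbracket : (2 : ℂ) • (angleProj θ * sgQ (q x t) * angleProj θ) -
      sgQ (q x t) * angleProj θ - angleProj θ * sgQ (q x t) =
      (-(Complex.I / 8)) • (reflMatrix (θ + (θ - q x t)) - reflMatrix (θ - (θ - q x t))) := by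
    rw [show θ + (θ - q x t) = 2 * θ - q x t by ring, sub_sub_cancel, ← reflMatrix_conj]
    simp only [angleProj_eq, sgQ, mul_smul_comm, smul_mul_assoc, mul_add, add_mul, mul_one, one_mul]
    module
  calc
    _ = (((s : ℂ) ^ 2)⁻¹ * (Complex.I * s)) •
        ((2 : ℂ) • (angleProj θ * sgQ (q x t) * angleProj θ) -
          sgQ (q x t) * angleProj θ - angleProj θ * sgQ (q x t)) := by
      rw [hnorm, star_I_mul_ofReal]
      module
    _ = _ := by
      rw [hbracket, reflMatrix_add_sub_reflMatrix_sub, smul_smul, smul_smul, backlundT]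
      congr 1
      push_cast
      field_simp
      linear_combination (-8 * Complex.sin (θ - q x t)) * Complex.I_mul_I

theorem isProjectionSystem_angleProj_iff (hq : IsSineGordon q) (hs : s ≠ 0)
    (hg : IsSineGordonFrame q g) (hfx : ∀ t, Differentiable ℝ fun x => f x t)
    (hft : ∀ x, Differentiable ℝ (f x)) :
    IsProjectionSystem sgA sgB (sgPotential q) g (Complex.I * s) (angleProj (f 0 0))
      (fun x t => angleProj (f x t)) ↔ IsBacklundAngle s q f := by
  have hconj (x t : ℝ) : (g x t)⁻¹ * sgB * g x t = sgQ (q x t) :=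
    congrFun₂ (hg.frameConj_eq hq) x t
  have hx (x t : ℝ) := hasMatDerivAt_angleProj_iff (c := backlundX s q ((x, t), f x t)) (hfx t x)
  have ht (x t : ℝ) := hasMatDerivAt_angleProj_iff (c := backlundT s q ((x, t), f x t)) (hft x t)
  simp only [← projectionSystem_x_angleProj] at hx
  simp only [← projectionSystem_t_angleProj q hs, ← hconj] at ht
  exact ⟨fun h => ⟨fun x t => (hx x t).mp (h.deriv_x x t), fun x t => (ht x t).mp (h.deriv_t x t)⟩,
    fun h => ⟨fun x t => (hx x t).mpr (h.deriv_x x t), fun x t => (ht x t).mpr (h.deriv_t x t),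
      fun x t => (isHermitianProjectionOnto_angleProj (f x t)).hermitian,
      fun x t => (isHermitianProjectionOnto_angleProj (f x t)).idempotent, rfl⟩⟩

end BacklundProjection

end LoopSG

end

/-- For a sine-Gordon solution `q` with potential `u`, the classical Bäcklund transform `qs` of `q`
exists and is unique, and its potential is `g_{is,π} ∗ u`, where `π` is the Hermitian projection
onto `(cos (f₀/2), sin (f₀/2))`; the system for the projection reduces to the classical one. -/
theorem proposition5p19 (q : ℝ → ℝ → ℝ) (hq : IsSineGordon q) (s : ℝ) (hs : s ≠ 0) (c₀ : ℝ)
    (f₀ : ℝ) (hf₀ : f₀ = (q 0 0 + c₀) / 2) (z : ℂ) (hz : z = Complex.I * (s : ℂ)) :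
    -- `π` is the projection onto the line, and `g_{is,π}` is a twisted rational loop
    IsHermitianProjectionOnto (angleProj f₀) (angleLine f₀) ∧
    IsTwistedRationalLoop (simpleElement z (angleProj f₀)) ∧
    -- `u` is a solution of the twisted `-1` flow
    (∀ x t, sgPotential q x t ∈ twistedPerp sgA) ∧
    IsSineGordonFrame q (sgFrame q) ∧
    (VanishesAtBot q → ∃ g, IsSineGordonFrame q g ∧ IsNormalizedFrame g) ∧
    ∃ qs : ℝ → ℝ → ℝ,
      -- `qs` is the classical Bäcklund transform of `q`
      IsClassicalBacklund s c₀ q qs ∧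
      (∀ r, IsClassicalBacklund s c₀ q r → r = qs) ∧
      IsSineGordon qs ∧
      ∀ g, IsSineGordonFrame q g →
        -- the potential of `qs` is `g_{is,π} ∗ u`
        IsDressing sgA sgB (sgPotential q) g (simpleElement z (angleProj f₀)) (sgPotential qs) ∧
        (∀ v, IsDressing sgA sgB (sgPotential q) g (simpleElement z (angleProj f₀)) v →
          v = sgPotential qs) ∧
        -- the projection onto `E(x,t,z)^*(π(ℂ²))` is the one of angle `(qs + q)/2`
        (∀ E, IsTrivialization sgA sgB (sgPotential q) g E → ∀ x t,
          IsHermitianProjectionOnto (angleProj ((qs x t + q x t) / 2))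
            ((angleLine f₀).map (Matrix.toLin' (E x t z).conjTranspose))) ∧
        (∀ x t, sgPotential qs x t = sgPotential q x t + (z - star z) •
          (angleProj ((qs x t + q x t) / 2) * sgA - sgA * angleProj ((qs x t + q x t) / 2))) ∧
        -- it is the unique solution of the system for the projection
        IsProjectionSystem sgA sgB (sgPotential q) g z (angleProj f₀)
          (fun x t => angleProj ((qs x t + q x t) / 2)) ∧
        (∀ P, IsProjectionSystem sgA sgB (sgPotential q) g z (angleProj f₀) P →
          P = fun x t => angleProj ((qs x t + q x t) / 2)) ∧
        -- which reduces to the classical system for `2 f - q`, `f` the angle of the projection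
        (∀ f : ℝ → ℝ → ℝ, (∀ t, Differentiable ℝ (fun x => f x t)) →
          (∀ x, Differentiable ℝ (fun t => f x t)) → f 0 0 = f₀ →
          (IsProjectionSystem sgA sgB (sgPotential q) g z (angleProj f₀)
              (fun x t => angleProj (f x t)) ↔
            IsClassicalBacklund s c₀ q (fun x t => 2 * f x t - q x t))) := by
  subst hf₀ hz
  obtain ⟨f, hf, hf0⟩ := hq.exists_isBacklundAngle hs ((q 0 0 + c₀) / 2)
  have hz0 : Complex.I * (s : ℂ) ≠ 0 := by simpa using hs
  have hz : star (Complex.I * (s : ℂ)) = -(Complex.I * s) := star_I_mul_ofReal s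
  refine ⟨isHermitianProjectionOnto_angleProj _,
    isTwistedRationalLoop_simpleElement (isStarProjection_angleProj _) (isSymm_angleProj _) hz,
    sgPotential_mem_twistedPerp q, hq.isSineGordonFrame_sgFrame, hq.exists_isNormalizedFrame,
    fun x t => 2 * f x t - q x t, (isClassicalBacklund_iff hq hs).mpr ⟨hf, by rw [hf0]; ring⟩,
    fun r hr => hr.eq_of_isBacklundAngle hf hq hs hf0, hf.isSineGordon hq hs, fun g hg => ?_⟩
  have hangle (x t : ℝ) : ((2 * f x t - q x t) + q x t) / 2 = f x t := by ring
  simp only [hangle, ← hf0, ← hf.dressedPotential_eq hq]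
  have hlax := hg.isLaxPair hq
  have hlax' := hf.isLaxPair_dressed hq hs hg
  have hsys := (isProjectionSystem_angleProj_iff hq hs hg
    (fun t x => (hf.deriv_x x t).differentiableAt)
    (fun x t => (hf.deriv_t x t).differentiableAt)).mpr hf
  refine ⟨hsys.isDressing hz0 hlax hlax', fun v hv =>
      hv.unique (hsys.isDressing hz0 hlax hlax') hlax, fun E hE x t => ?_, fun x t => rfl, hsys,
    fun P hP => hP.unique hsys hlax, fun f' hfx hft h0 => ?_⟩
  · rw [← (isHermitianProjectionOnto_angleProj (f 0 0)).range_eq]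
    exact hsys.isHermitianProjectionOnto hz0 (by rwa [hz, ne_eq, self_eq_neg]) hlax hlax'
      (isTrivialization_iff_isLaxFrame.mp hE) x t
  · rw [← h0, isProjectionSystem_angleProj_iff hq hs hg hfx hft, isClassicalBacklund_iff hq hs]
    exact (and_iff_left (by rw [h0, hf0]; ring)).symm
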